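/- Let $\varphi,\psi:\mathbb R\to\mathbb R$ be unbounded functions that are equal to $1$ on $(-\infty,1]$ and strictly increasing on $[1,\infty)$. Suppose that $\varphi(x)=o\big((\log x)^j\big)$ as $x\to\infty$ for every real $j>0$, and that for some real $k>0$ $$\frac{\varphi(u)^{k/(k+1)}}{\psi(u)}\longrightarrow\infty\qquad(u\to\infty).$$ For a probability space $(X,\Sigma,\mu)$ let $L\varphi(L)$ be the set of measurable $f:X\to\mathbb R$ with $\int_X|f|\,\varphi(|f|)\,d\mu<\infty$, and define $L\psi(L)$ likewise. An aperiodic measure-preserving system is a (not necessarily invertible) measure-preserving map $T$ of a probability space $(X,\Sigma,\mu)$ whose $\sigma$-algebra is countably separated (for instance a standard Borel space or its completion), such that $\mu\{x: T^n x=x\}=0$ for every $n\ge 1$. Then there is a strictly increasing sequence $(a_n)_{n\ge1}$ of positive integers such that, for every aperiodic measure-preserving system $(X,\Sigma,\mu,T)$: 1. ($(a_n)$ is universally $L\varphi(L)$-good) for every $f\in L\varphi(L)$ the averages $\frac1N\sum_{n=1}^N f(T^{a_n}x)$ converge to a finite limit as $N\to\infty$ for $\mu$-almost every $x$; 2. ($(a_n)$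 is universally $\infty$-sweeping out in $L\psi(L)$) there is an $f\in L\psi(L)$ with $\sup_{N\ge1}\frac1N\sum_{n=1}^N f(T^{a_n}x)=\infty$ for $\mu$-almost every $x$. -/

import Mathlib

open MeasureTheory Filter Topology

universe u

/-- Gauge functions: equal to `1` on `(-∞, 1]`, strictly increasing from there on
(that is, on `[1, ∞)`), and unbounded. No continuity is required. -/
structure IsGauge (φ : ℝ → ℝ) : Prop where
  eq_one : ∀ x ≤ 1, φ x = 1
  strictMonoOn : StrictMonoOn φ (Set.Ici 1)
  unbounded : ¬ BddAbove (Set.range φ)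

/-- Aperiodic (free) measure-preserving systems on a probability space: `T` preserves the
probability measure `μ`, and for every `n ≥ 1` almost no point has `T^n x = x`.
`T` need not be invertible. -/
structure IsAperiodicSystem {X : Type u} [MeasurableSpace X] (μ : Measure X) (T : X → X) :
    Prop where
  isProbabilityMeasure : IsProbabilityMeasure μ
  measurePreserving : MeasurePreserving T μ μ
  aperiodic : ∀ n : ℕ, 1 ≤ n → ∀ᵐ x ∂μ, T^[n] x ≠ x

/-- The ergodic average `(1/N) ∑ f(T^{a} x)` over the first `N` terms of the sequence
(whose first term is `a 0`). -/
noncomputable def ergodicAverage {X : Type u} (a : ℕ → ℕ) (T : X → X) (f : X → ℝ) (N : ℕ)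
    (x : X) : ℝ :=
  (1 / (N : ℝ)) * ∑ n ∈ Finset.range N, f (T^[a n] x)

/-- A function space: a rule that assigns to every measure space a set of real functions. -/
abbrev FunctionSpace : Type (u + 1) :=
  (X : Type u) → [MeasurableSpace X] → Measure X → Set (X → ℝ)

/-- The space `Lφ(L)` of (a.e.-)measurable real `f` with `∫ |f| φ(|f|) dμ < ∞`. -/
def orliczSpace (φ : ℝ → ℝ) : FunctionSpace.{u} := fun _ _ μ =>
  {f | AEMeasurable f μ ∧ ∫⁻ x, ENNReal.ofReal (|f x| * φ |f x|) ∂μ < ⊤}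

/-- `a` is universally `F`-good: in every aperiodic measure-preserving system, the averages of
every `f ∈ F` converge (to a finite limit) almost everywhere.

The underlying measurable space is countably separated (this includes all standard Borel spaces
and their completions), so that aperiodicity in terms of points is meaningful. -/
def UniversallyGood (F : FunctionSpace.{u}) (a : ℕ → ℕ) : Prop :=
  ∀ (X : Type u) [MeasurableSpace X] [MeasurableSpace.CountablySeparated X]
    (μ : Measure X) (T : X → X), IsAperiodicSystem μ T →
    ∀ f ∈ F X μ, ∀ᵐ x ∂μ, ∃ l : ℝ,
      Tendsto (fun N : ℕ => ergodicAverage a T f N x) atTop (𝓝 l)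

/-- `a` is universally `∞`-sweeping out in `F`: every aperiodic measure-preserving system has
an `f ∈ F` whose averages have supremum `+∞` almost everywhere. -/
def UniversallySweepingOut (F : FunctionSpace.{u}) (a : ℕ → ℕ) : Prop :=
  ∀ (X : Type u) [MeasurableSpace X] [MeasurableSpace.CountablySeparated X]
    (μ : Measure X) (T : X → X), IsAperiodicSystem μ T →
    ∃ f ∈ F X μ, ∀ᵐ x ∂μ,
      ⨆ N : ℕ, ((ergodicAverage a T f N x : ℝ) : EReal) = ⊤

/-! The sequence enumerates the union of a main set, along which averages of every integrable
function converge, and a sparse extra set, which decides between `φ` and `ψ`.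

Initial parts of the main set fill a fixed proportion of two-dimensional rectangles `{a Q + b}`.
These form a chain and have difference sets of comparable size, so a Vitali argument and
transference give a weak type (1,1) maximal inequality (`maximal_inequality`). The main set also
consists of ever longer intervals, so it is asymptotically shift invariant and the mean ergodic
theorem identifies the limit up to a small error. Together these give almost everywhere convergence
in L¹ (`ae_exists_tendsto_initialAverage`).

Stage `s` adds `K` extra intervals, the `j`-th of length `2 ^ j * w`, placed where the main set has
about `2 ^ j * d * w` points. Such an interval has relative weight `1 / d`, so it disturbs an
average by `ε` only if `|f|` averages more than `ε d` over it. By Markov's inequality this has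
probability `O(1 / (d φ(√d)))` when `f ∈ Lφ(L)`. If `K 2 ^ s ≤ d φ(√d)`, the Borel–Cantelli lemma
leaves finitely many bad intervals per point (`ae_finite_blockSum`).

Conversely, the starting points of the `K` intervals run through `K` residue classes modulo `V`. A
Rokhlin-type height function then yields a set `E` of measure at most `4 / K` that contains, for
most points, a whole orbit segment along one of the intervals (`exists_stage_set`). Giving `E` the
value `h = 5 (s + 1) d` forces an average of at least `s + 1`, at a cost of about `h ψ(h) / K`,
which is summable if `2 ^ s h ψ(h) ≤ K`.

Both demands on `K` can be met if `φ(√d)` is much larger than `ψ(c d)`, where `c = 5 (s + 1)`. The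
power hypothesis gives `ψ = o(φ)`. Moreover `φ` cannot double from `v` to `v ^ 4` for all large `v`,
since it would then grow like `√log`. Hence `d ≈ v ^ 4 / c` works for suitable `v`
(`exists_parameters`). -/

/-! ### Covering and the weak type maximal inequality -/

/-- The set of differences `{a - b : a, b ∈ F}`. -/
def differenceFinset (F : Finset ℕ) : Finset ℤ :=
  (F ×ˢ F).image fun p => (p.1 : ℤ) - p.2

/-- Vitali covering on `ℕ` for a chain of finite sets with small difference sets. -/
theorem chain_covering_inequality {C R J : ℕ} {𝓕 : Set (Finset ℕ)}
    (hchain : IsChain (· ⊆ ·) 𝓕) (hne : ∀ F ∈ 𝓕, F.Nonempty)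
    (hdiff : ∀ F ∈ 𝓕, (differenceFinset F).card ≤ C * F.card)
    (hR : ∀ F ∈ 𝓕, F ⊆ Finset.range R) (g : ℕ → ENNReal) (r : ENNReal) (E : Finset ℕ)
    (hE : ∀ n ∈ E, n < J ∧ ∃ F ∈ 𝓕, r * F.card ≤ ∑ m ∈ F, g (n + m)) :
    r * E.card ≤ C * ∑ k ∈ Finset.range (J + R), g k := by
  classical
  have hE' : ∀ n ∈ E, ∃ F ∈ 𝓕, r * F.card ≤ ∑ m ∈ F, g (n + m) := fun n hn => (hE n hn).2
  choose! F hF hFr using hE'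
  have hcard : ∀ n ∈ E, (F n).card ≤ R := fun n hn => by
    simpa using Finset.card_le_card (hR _ (hF n hn))
  -- The weight `3 ^ card` with enlargement factor `2` makes the selection exact: `3 ^ p ≤ 2 * 3 ^
  -- q` forces `p ≤ q`. In a chain this means that each translate meets a selected one whose shape
  -- contains its own.
  obtain ⟨u, huE, hdisj, hcov⟩ := Vitali.exists_disjoint_subfamily_covering_enlargement
    (fun n => (((F n).image (n + ·) : Finset ℕ) : Set ℕ)) (E : Set ℕ)
    (fun n => (3 : ℝ) ^ (F n).card) 2 (by norm_num) (fun _ _ => by positivity) (3 ^ R)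
    (fun n hn => pow_le_pow_right₀ (by norm_num) (hcard n hn))
    (fun n hn => by simpa using hne _ (hF n hn))
  set U : Finset ℕ := E.filter (· ∈ u) with hU
  have hUE : ∀ b ∈ U, b ∈ E := fun b hb => (Finset.mem_filter.1 hb).1
  have hsub : E ⊆ U.biUnion fun b => (differenceFinset (F b)).image fun z => ((b : ℤ) + z).toNat := by
    intro n hn
    obtain ⟨b, hb, ⟨z, hz1, hz2⟩, hle⟩ := hcov n hn
    have hbE : b ∈ E := huE hb
    have hcd : (F n).card ≤ (F b).card := by
      by_contra h
      have h1 : (3 : ℝ) ^ ((F b).card + 1) ≤ 3 ^ (F n).card :=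
        pow_le_pow_right₀ (by norm_num) (by omega)
      have h2 : (0 : ℝ) < 3 ^ (F b).card := by positivity
      rw [pow_succ] at h1
      linarith
    have hss : F n ⊆ F b := by
      rcases hchain.total (hF n hn) (hF b hbE) with h | h
      · exact h
      · exact (Finset.eq_of_subset_of_card_le h hcd).ge
    simp only [Finset.coe_image, Set.mem_image, Finset.mem_coe] at hz1 hz2
    obtain ⟨a, ha, rfl⟩ := hz1
    obtain ⟨c, hc, hac⟩ := hz2
    simp only [Finset.mem_biUnion, Finset.mem_image]
    refine ⟨b, Finset.mem_filter.2 ⟨hbE, hb⟩, (c : ℤ) - a, ?_, by omega⟩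
    exact Finset.mem_image.2 ⟨(c, a), Finset.mem_product.2 ⟨hc, hss ha⟩, rfl⟩
  have hEcard : E.card ≤ ∑ b ∈ U, C * (F b).card := by
    refine (Finset.card_le_card hsub).trans (Finset.card_biUnion_le.trans ?_)
    exact Finset.sum_le_sum fun b hb => Finset.card_image_le.trans (hdiff _ (hF b (hUE b hb)))
  have hsum : ∑ b ∈ U, ∑ m ∈ F b, g (b + m) ≤ ∑ k ∈ Finset.range (J + R), g k := by
    have h1 : ∀ b ∈ U, ∑ m ∈ F b, g (b + m) = ∑ k ∈ (F b).image (b + ·), g k := fun b _ => by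
      rw [Finset.sum_image fun x _ y _ h => by simpa using h]
    rw [Finset.sum_congr rfl h1, ← Finset.sum_biUnion]
    · refine Finset.sum_le_sum_of_subset fun k hk => ?_
      simp only [Finset.mem_biUnion, Finset.mem_image] at hk
      obtain ⟨b, hb, m, hm, rfl⟩ := hk
      have h2 := (hE b (hUE b hb)).1
      have h3 := Finset.mem_range.1 (hR _ (hF b (hUE b hb)) hm)
      exact Finset.mem_range.2 (by omega)
    · intro b hb c hc hbc
      have := hdisj (Finset.mem_filter.1 hb).2 (Finset.mem_filter.1 hc).2 hbc
      exact Finset.disjoint_coe.1 this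
  calc r * E.card ≤ r * ((∑ b ∈ U, C * (F b).card : ℕ) : ENNReal) := by gcongr
    _ = C * ∑ b ∈ U, r * (F b).card := by
        push_cast
        rw [← Finset.mul_sum, ← Finset.mul_sum]; ring
    _ ≤ C * ∑ b ∈ U, ∑ m ∈ F b, g (b + m) := by
        gcongr with b hb
        exact hFr b (hUE b hb)
    _ ≤ _ := by gcongr

section
variable {X : Type u} [MeasurableSpace X] {μ : Measure X} {T : X → X}

/-- Transference: apply the covering inequality to `k ↦ f (T^k x)` on a window of length `J` and
integrate. The loss of `R` at the edge disappears as `J → ∞`. -/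
theorem maximal_inequality_of_bounded [IsFiniteMeasure μ] (hT : MeasurePreserving T μ μ) {C R : ℕ}
    {𝓕 : Set (Finset ℕ)} (hchain : IsChain (· ⊆ ·) 𝓕) (hne : ∀ F ∈ 𝓕, F.Nonempty)
    (hdiff : ∀ F ∈ 𝓕, (differenceFinset F).card ≤ C * F.card)
    (hR : ∀ F ∈ 𝓕, F ⊆ Finset.range R) {f : X → ENNReal} (hf : Measurable f)
    (hfi : ∫⁻ x, f x ∂μ ≠ ⊤) {r : ENNReal} (hr : r ≠ ⊤) :
    r * μ {x | ∃ F ∈ 𝓕, r * F.card ≤ ∑ m ∈ F, f (T^[m] x)} ≤ C * ∫⁻ x, f x ∂μ := by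
  classical
  set S : Set X := {x | ∃ F ∈ 𝓕, r * F.card ≤ ∑ m ∈ F, f (T^[m] x)} with hS
  have hfT : ∀ m, Measurable fun x => f (T^[m] x) := fun m => hf.comp (hT.iterate m).measurable
  have hSm : MeasurableSet S := by
    have : S = ⋃ F ∈ 𝓕, {x | r * F.card ≤ ∑ m ∈ F, f (T^[m] x)} := by
      ext x; simp [hS]
    rw [this]
    exact MeasurableSet.biUnion (Set.to_countable _) fun F _ =>
      measurableSet_le measurable_const (Finset.measurable_fun_sum _ fun m _ => hfT m)
  have key : ∀ J : ℕ, (J : ENNReal) * (r * μ S) ≤ (J + R : ℕ) * (C * ∫⁻ x, f x ∂μ) := by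
    intro J
    have h1 : ∀ x, ∑ n ∈ Finset.range J, r * S.indicator 1 (T^[n] x)
        ≤ C * ∑ k ∈ Finset.range (J + R), f (T^[k] x) := by
      intro x
      have := chain_covering_inequality (J := J) hchain hne hdiff hR (fun k => f (T^[k] x)) r
        ((Finset.range J).filter fun n => T^[n] x ∈ S) (by
          intro n hn
          simp only [Finset.mem_filter, Finset.mem_range] at hn
          refine ⟨hn.1, ?_⟩
          obtain ⟨F, hF, h⟩ := hn.2
          refine ⟨F, hF, ?_⟩
          simpa only [add_comm n, Function.iterate_add_apply] using h)
      refine le_trans (le_of_eq ?_) this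
      rw [← Finset.mul_sum, Finset.card_filter]
      push_cast
      congr 1
    have h2 := lintegral_mono (μ := μ) h1
    rw [lintegral_finsetSum _ (fun n _ => by
        have : Measurable (S.indicator (1 : X → ENNReal)) := measurable_one.indicator hSm
        exact (this.comp (hT.iterate n).measurable).const_mul _),
      lintegral_const_mul _ (Finset.measurable_fun_sum _ fun m _ => hfT m),
      lintegral_finsetSum _ (fun m _ => hfT m)] at h2
    have h3 : ∀ n, ∫⁻ x, r * S.indicator 1 (T^[n] x) ∂μ = r * μ S := fun n => by
      have hm : Measurable (S.indicator (1 : X → ENNReal)) := measurable_one.indicator hSm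
      rw [(hT.iterate n).lintegral_comp (f := fun y => r * S.indicator 1 y) (hm.const_mul _),
        lintegral_const_mul _ hm, lintegral_indicator_one hSm]
    have h4 : ∀ n, ∫⁻ x, f (T^[n] x) ∂μ = ∫⁻ x, f x ∂μ := fun n =>
      (hT.iterate n).lintegral_comp hf
    simp only [h3, h4, Finset.sum_const, Finset.card_range, nsmul_eq_mul] at h2
    calc _ ≤ _ := h2
      _ = _ := by ring
  have hA : r * μ S ≠ ⊤ := ENNReal.mul_ne_top hr (measure_ne_top _ _)
  have hB : C * ∫⁻ x, f x ∂μ ≠ ⊤ := ENNReal.mul_ne_top (by simp) hfi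
  lift r * μ S to NNReal using hA with a
  lift C * ∫⁻ x, f x ∂μ to NNReal using hB with b
  rw [ENNReal.coe_le_coe]
  have key' : ∀ J : ℕ, (J : ℝ) * a ≤ (J + R) * b := fun J => by
    have := key J
    exact_mod_cast this
  by_contra hlt
  have hlt' : (0 : ℝ) < (a : ℝ) - b := by
    have : (b : ℝ) < a := by exact_mod_cast not_le.1 hlt
    linarith
  obtain ⟨J, hJ⟩ := exists_nat_gt (R * b / ((a : ℝ) - b))
  rw [div_lt_iff₀ hlt'] at hJ
  nlinarith [key' J]

/-- Weak type `(1,1)` maximal inequality for averages over a chain of finite sets with small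
difference sets. -/
theorem maximal_inequality [IsFiniteMeasure μ] (hT : MeasurePreserving T μ μ) {C : ℕ}
    {𝓕 : Set (Finset ℕ)} (hchain : IsChain (· ⊆ ·) 𝓕) (hne : ∀ F ∈ 𝓕, F.Nonempty)
    (hdiff : ∀ F ∈ 𝓕, (differenceFinset F).card ≤ C * F.card)
    {f : X → ENNReal} (hf : Measurable f)
    (hfi : ∫⁻ x, f x ∂μ ≠ ⊤) {r : ENNReal} (hr : r ≠ ⊤) :
    r * μ {x | ∃ F ∈ 𝓕, r * F.card ≤ ∑ m ∈ F, f (T^[m] x)} ≤ C * ∫⁻ x, f x ∂μ := by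
  have hU : {x | ∃ F ∈ 𝓕, r * F.card ≤ ∑ m ∈ F, f (T^[m] x)} =
      ⋃ R : ℕ, {x | ∃ F ∈ {F ∈ 𝓕 | F ⊆ Finset.range R}, r * F.card ≤ ∑ m ∈ F, f (T^[m] x)} := by
    ext x
    simp only [Set.mem_ofPred_eq, Set.mem_iUnion]
    constructor
    · rintro ⟨F, hF, h⟩
      exact ⟨F.sup id + 1, F, ⟨hF, fun m hm => Finset.mem_range.2
        (Nat.lt_succ_of_le (Finset.le_sup (f := id) hm))⟩, h⟩
    · rintro ⟨R, F, hF, h⟩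
      exact ⟨F, hF.1, h⟩
  rw [hU, Monotone.measure_iUnion, ENNReal.mul_iSup]
  · refine iSup_le fun R => maximal_inequality_of_bounded hT (R := R)
      (hchain.mono fun F hF => hF.1) (fun F hF => hne F hF.1) (fun F hF => hdiff F hF.1)
      (fun F hF => hF.2) hf hfi hr
  · intro R R' hRR' x hx
    obtain ⟨F, hF, h⟩ := hx
    exact ⟨F, ⟨hF.1, hF.2.trans (Finset.range_mono hRR')⟩, h⟩

end

/-! ### Pointwise convergence along sets with few ends -/

open Classical in
/-- The elements of `S` below `y`. -/
noncomputable def initialPart (S : Set ℕ) (y : ℕ) : Finset ℕ :=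
  (Finset.range y).filter (· ∈ S)

open Classical in
/-- The elements `m` of `S` below `y` with `m + 1 ∉ S`. -/
noncomputable def initialEnds (S : Set ℕ) (y : ℕ) : Finset ℕ :=
  (Finset.range y).filter fun m => m ∈ S ∧ m + 1 ∉ S

theorem mem_initialPart {S : Set ℕ} {y m : ℕ} : m ∈ initialPart S y ↔ m < y ∧ m ∈ S := by
  simp [initialPart]

theorem mem_initialEnds {S : Set ℕ} {y m : ℕ} :
    m ∈ initialEnds S y ↔ m < y ∧ m ∈ S ∧ m + 1 ∉ S := by
  simp [initialEnds]

/-- The terms cancel except on the symmetric difference of the initial part and its shift by one. A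
point of the shift that is not in the initial part follows an end or equals `y`, whence the `+ 1`.
The two halves of the symmetric difference have equal size. -/
theorem abs_sum_coboundary_le (S : Set ℕ) (y : ℕ) {b : ℕ → ℝ} {B : ℝ} (hb : ∀ n, |b n| ≤ B) :
    |∑ m ∈ initialPart S y, (b m - b (m + 1))| ≤ 2 * B * ((initialEnds S y).card + 1) := by
  classical
  have hB : 0 ≤ B := (abs_nonneg _).trans (hb 0)
  set P := initialPart S y with hP
  set P' := P.image (· + 1) with hP'
  have h1 : ∑ m ∈ P, b (m + 1) = ∑ m ∈ P', b m := by
    rw [hP', Finset.sum_image fun x _ z _ h => by simpa using h]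
  have hc : P.card = P'.card := (Finset.card_image_of_injective _ (add_left_injective 1)).symm
  have h2 : (P' \ P).card ≤ (initialEnds S y).card + 1 := by
    have : P' \ P ⊆ insert y ((initialEnds S y).image (· + 1)) := by
      intro m hm
      simp only [hP', Finset.mem_sdiff, Finset.mem_image, hP, mem_initialPart] at hm
      obtain ⟨⟨n, ⟨hn, hnS⟩, rfl⟩, hm2⟩ := hm
      simp only [Finset.mem_insert, Finset.mem_image, mem_initialEnds]
      by_cases h : n + 1 = y
      · exact Or.inl h
      · exact Or.inr ⟨n, ⟨hn, hnS, fun h' => hm2 ⟨by omega, h'⟩⟩, rfl⟩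
    have hi : ((initialEnds S y).image (· + 1)).card ≤ (initialEnds S y).card :=
      Finset.card_image_le
    exact (Finset.card_le_card this).trans ((Finset.card_insert_le _ _).trans (by omega))
  have hbd : ∀ s : Finset ℕ, |∑ m ∈ s, b m| ≤ s.card * B := fun s =>
    (Finset.abs_sum_le_sum_abs _ _).trans
      ((Finset.sum_le_sum fun m _ => hb m).trans (by simp))
  rw [Finset.sum_sub_distrib, h1, ← Finset.sum_sdiff_sub_sum_sdiff (s₁ := P') (s₂ := P)]
  have h3 : ((P' \ P).card : ℝ) ≤ (initialEnds S y).card + 1 := by exact_mod_cast h2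
  have h4 := hbd (P \ P')
  have h5 := hbd (P' \ P)
  rw [Finset.card_sdiff_comm hc] at h4
  have h6 := abs_sub (∑ x ∈ P \ P', b x) (∑ x ∈ P' \ P, b x)
  nlinarith

theorem abs_sum_sub_shift_le (S : Set ℕ) (y : ℕ) {b : ℕ → ℝ} {B : ℝ} (hb : ∀ n, |b n| ≤ B)
    (k : ℕ) :
    |∑ m ∈ initialPart S y, (b m - b (m + k))| ≤ k * (2 * B * ((initialEnds S y).card + 1)) := by
  induction k with
  | zero => simp
  | succ k ih =>
    have h1 := abs_sum_coboundary_le S y (b := fun n => b (n + k)) fun n => hb (n + k)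
    have h2 : ∑ m ∈ initialPart S y, (b m - b (m + (k + 1))) =
        ∑ m ∈ initialPart S y, (b m - b (m + k)) +
          ∑ m ∈ initialPart S y, (b (m + k) - b (m + 1 + k)) := by
      rw [← Finset.sum_add_distrib]
      refine Finset.sum_congr rfl fun m _ => ?_
      rw [show m + 1 + k = m + (k + 1) by ring]; ring
    rw [h2]
    refine (abs_add_le _ _).trans ?_
    push_cast
    linarith

section
variable {X : Type u} [MeasurableSpace X] {μ : Measure X} {T : X → X}

/-- Mean ergodic approximation for bounded functions. -/
theorem exists_birkhoffAverage_near_invariant [IsProbabilityMeasure μ]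
    (hT : MeasurePreserving T μ μ) {b : X → ℝ} (hb : Measurable b) {B : ℝ} (hB : ∀ x, |b x| ≤ B)
    {ε : ENNReal} (hε : ε ≠ 0) :
    ∃ p : ℕ, 0 < p ∧ ∃ g : X → ℝ, Measurable g ∧ g ∘ T =ᵐ[μ] g ∧
      ∫⁻ x, ‖(p : ℝ)⁻¹ * ∑ k ∈ Finset.range p, b (T^[k] x) - g x‖ₑ ∂μ ≤ ε := by
  have hbL : MemLp b 2 μ := MemLp.of_bound hb.aestronglyMeasurable B (ae_of_all _ hB)
  have hbT : ∀ k, MemLp (b ∘ T^[k]) 2 μ := fun k => hbL.comp_measurePreserving (hT.iterate k)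
  set U := (Lp.compMeasurePreservingₗᵢ (E := ℝ) (p := 2) ℝ T hT).toContinuousLinearMap with hU
  have hlim := U.tendsto_birkhoffAverage_orthogonalProjection
    (LinearIsometry.norm_toContinuousLinearMap_le _) (hbL.toLp b)
  set π : Lp ℝ 2 μ := ((U.eqLocus (1 : Lp ℝ 2 μ →L[ℝ] Lp ℝ 2 μ)).orthogonalProjectionOnto
    (hbL.toLp b) : Lp ℝ 2 μ) with hπ
  have hπU : U π = π := ((U.eqLocus (1 : Lp ℝ 2 μ →L[ℝ] Lp ℝ 2 μ)).orthogonalProjectionOnto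
    (hbL.toLp b)).2
  have hiter : ∀ k, U^[k] (hbL.toLp b) = (hbT k).toLp _ := by
    intro k
    induction k with
    | zero => rfl
    | succ k ih =>
      rw [Function.iterate_succ_apply', ih]
      exact Lp.toLp_compMeasurePreserving (hbT k) hT
  obtain ⟨g, hgm, hg⟩ := (Lp.aestronglyMeasurable π).aemeasurable
  have hlim' : Tendsto (fun p => ‖birkhoffAverage ℝ U id p (hbL.toLp b) - π‖ₑ) atTop (𝓝 0) := by
    have := (hlim.sub_const π).enorm
    simpa using this
  obtain ⟨p, hp0, hp⟩ := ((eventually_gt_atTop 0).and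
    (hlim'.eventually (gt_mem_nhds (pos_iff_ne_zero.2 hε)))).exists
  refine ⟨p, hp0, g, hgm, ?_, ?_⟩
  · have h1 : (U π : X → ℝ) =ᵐ[μ] π ∘ T := Lp.coeFn_compMeasurePreserving π hT
    rw [hπU] at h1
    have h2 : π ∘ T =ᵐ[μ] g ∘ T := hT.quasiMeasurePreserving.ae_eq_comp hg
    exact (h2.symm.trans h1.symm).trans hg
  · have hae : (fun x => (p : ℝ)⁻¹ * ∑ k ∈ Finset.range p, b (T^[k] x) - g x) =ᵐ[μ]
        (birkhoffAverage ℝ U id p (hbL.toLp b) - π : Lp ℝ 2 μ) := by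
      have h1 := Lp.coeFn_sub (birkhoffAverage ℝ U id p (hbL.toLp b)) π
      have h2 : ((birkhoffAverage ℝ U id p (hbL.toLp b) : Lp ℝ 2 μ) : X → ℝ) =ᵐ[μ]
          (p : ℝ)⁻¹ • ((birkhoffSum U id p (hbL.toLp b) : Lp ℝ 2 μ) : X → ℝ) := Lp.coeFn_smul _ _
      have h3 := Lp.coeFn_fun_finsetSum (Finset.range p) fun k => (hbT k).toLp (b ∘ T^[k])
      have h4 : birkhoffSum U id p (hbL.toLp b) =
          ∑ k ∈ Finset.range p, (hbT k).toLp (b ∘ T^[k]) :=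
        Finset.sum_congr rfl fun k _ => hiter k
      rw [← h4] at h3
      have h5 : ∀ᵐ x ∂μ, ∀ k, ((hbT k).toLp (b ∘ T^[k]) : X → ℝ) x = b (T^[k] x) :=
        ae_all_iff.2 fun k => (hbT k).coeFn_toLp
      filter_upwards [h1, h2, h3, h5, hg] with x e1 e2 e3 e5 e6
      rw [e1, Pi.sub_apply, e2, Pi.smul_apply, e3, e6]
      simp [e5]
    calc ∫⁻ x, ‖(p : ℝ)⁻¹ * ∑ k ∈ Finset.range p, b (T^[k] x) - g x‖ₑ ∂μ
        = eLpNorm (birkhoffAverage ℝ U id p (hbL.toLp b) - π : Lp ℝ 2 μ) 1 μ := by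
          rw [eLpNorm_one_eq_lintegral_enorm]
          exact lintegral_congr_ae (hae.mono fun x hx => by simp only [hx])
      _ ≤ eLpNorm (birkhoffAverage ℝ U id p (hbL.toLp b) - π : Lp ℝ 2 μ) 2 μ :=
          eLpNorm_le_eLpNorm_of_exponent_le (by norm_num) (Lp.aestronglyMeasurable _)
      _ = ‖birkhoffAverage ℝ U id p (hbL.toLp b) - π‖ₑ := (Lp.enorm_def _).symm
      _ ≤ ε := hp.le

end
section
variable {X : Type u} [MeasurableSpace X] {μ : Measure X} {T : X → X}

/-- The average of `f ∘ T^m` over the elements `m < y` of `S`. -/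
noncomputable def initialAverage (S : Set ℕ) (T : X → X) (f : X → ℝ) (y : ℕ) (x : X) : ℝ :=
  (∑ m ∈ initialPart S y, f (T^[m] x)) / (initialPart S y).card

/-- Write `f - c = (f - b) + (average of b - c) + (b - average of b)`. The last summand is a mean of
differences `b m - b (m + k)` with `k < p`, which nearly telescope. -/
theorem abs_sum_initialPart_sub_le {S : Set ℕ} {y p : ℕ} (hp : 0 < p) {f b : ℕ → ℝ} {B : ℝ}
    (hb : ∀ n, |b n| ≤ B) (c : ℝ) :
    |∑ m ∈ initialPart S y, (f m - c)| ≤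
      ∑ m ∈ initialPart S y,
        (|f m - b m| + |(p : ℝ)⁻¹ * ∑ k ∈ Finset.range p, b (m + k) - c|) +
      p * (2 * B * ((initialEnds S y).card + 1)) := by
  have hB : 0 ≤ B := (abs_nonneg _).trans (hb 0)
  have hp' : (p : ℝ) ≠ 0 := by positivity
  set P := initialPart S y
  set E : ℝ := 2 * B * ((initialEnds S y).card + 1)
  have hE : 0 ≤ E := by positivity
  have h1 : ∑ m ∈ P, (f m - c) = ∑ m ∈ P, ((f m - b m) +
      ((p : ℝ)⁻¹ * ∑ k ∈ Finset.range p, b (m + k) - c)) +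
      (p : ℝ)⁻¹ * ∑ k ∈ Finset.range p, ∑ m ∈ P, (b m - b (m + k)) := by
    rw [Finset.sum_comm, Finset.mul_sum, ← Finset.sum_add_distrib]
    refine Finset.sum_congr rfl fun m _ => ?_
    rw [Finset.sum_sub_distrib]
    simp only [Finset.sum_const, Finset.card_range, nsmul_eq_mul]
    field_simp
    ring
  have h2 : |(p : ℝ)⁻¹ * ∑ k ∈ Finset.range p, ∑ m ∈ P, (b m - b (m + k))| ≤ p * E := by
    rw [abs_mul, abs_of_nonneg (by positivity : (0 : ℝ) ≤ (p : ℝ)⁻¹)]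
    have h3 : |∑ k ∈ Finset.range p, ∑ m ∈ P, (b m - b (m + k))| ≤
        ∑ k ∈ Finset.range p, p * E := by
      refine (Finset.abs_sum_le_sum_abs _ _).trans (Finset.sum_le_sum fun k hk => ?_)
      refine (abs_sum_sub_shift_le S y hb k).trans ?_
      have : (k : ℝ) ≤ p := by exact_mod_cast (Finset.mem_range.1 hk).le
      gcongr
    rw [Finset.sum_const, Finset.card_range, nsmul_eq_mul] at h3
    rwa [inv_mul_le_iff₀ (by positivity)]
  rw [h1]
  refine (abs_add_le _ _).trans (add_le_add ?_ h2)
  exact (Finset.abs_sum_le_sum_abs _ _).trans (Finset.sum_le_sum fun m _ => abs_add_le _ _)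

/-- Almost everywhere convergence for integrable functions of the averages along a set `S` whose
initial parts fill a fixed proportion of members of a chain with small difference sets and have
relatively few ends. -/
theorem ae_exists_tendsto_initialAverage [IsProbabilityMeasure μ] (hT : MeasurePreserving T μ μ)
    {S : Set ℕ} {C D y₀ : ℕ} {𝓕 : Set (Finset ℕ)} (hchain : IsChain (· ⊆ ·) 𝓕)
    (hne : ∀ F ∈ 𝓕, F.Nonempty) (hdiff : ∀ F ∈ 𝓕, (differenceFinset F).card ≤ C * F.card)
    (hD : 0 < D)
    (hdom : ∀ y ≥ y₀, ∃ F ∈ 𝓕, initialPart S y ⊆ F ∧ F.card ≤ D * (initialPart S y).card)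
    (hends : Tendsto (fun y => (((initialEnds S y).card : ℝ) + 1) / (initialPart S y).card)
      atTop (𝓝 0))
    {f : X → ℝ} (hf : Measurable f) (hfi : Integrable f μ) :
    ∀ᵐ x ∂μ, ∃ l, Tendsto (fun y => initialAverage S T f y x) atTop (𝓝 l) := by
  have hpos : ∀ y ≥ y₀, 0 < (initialPart S y).card := fun y hy => by
    obtain ⟨F, hF, -, h⟩ := hdom y hy
    have := (hne F hF).card_pos
    exact Nat.pos_of_ne_zero fun h0 => by rw [h0] at h; omega
  have main : ∀ lam : ℝ, 0 < lam → ∀ᵐ x ∂μ, ∃ Y, ∀ y ≥ Y, ∀ y' ≥ Y,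
      |initialAverage S T f y x - initialAverage S T f y' x| ≤ 4 * lam := by
    intro lam hlam
    rw [ae_iff]
    set Z := {x | ¬∃ Y, ∀ y ≥ Y, ∀ y' ≥ Y,
      |initialAverage S T f y x - initialAverage S T f y' x| ≤ 4 * lam} with hZ
    set r : ENNReal := ENNReal.ofReal (lam / D) with hr
    have hr0 : r ≠ 0 := by
      have : 0 < lam / D := by positivity
      simpa [hr] using this
    -- The level `r` is fixed while the approximation error `ε` tends to zero, so the divergence set
    -- is null.
    suffices h : ∀ ε : ENNReal, ε ≠ 0 → r * μ Z ≤ C * (ε + ε) by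
      have h0 : r * μ Z = 0 := by
        have hlim : Tendsto (fun n : ℕ => (C : ENNReal) * ((n : ENNReal)⁻¹ + (n : ENNReal)⁻¹))
            atTop (𝓝 (C * (0 + 0))) :=
          ENNReal.Tendsto.const_mul (ENNReal.tendsto_inv_nat_nhds_zero.add
            ENNReal.tendsto_inv_nat_nhds_zero) (Or.inr (by simp))
        have := ge_of_tendsto' hlim fun n => h (n : ENNReal)⁻¹ (by simp)
        simpa using this
      exact (mul_eq_zero.1 h0).resolve_left hr0
    intro ε hε
    obtain ⟨s, hs, -⟩ := (memLp_one_iff_integrable.2 hfi).exists_simpleFunc_eLpNorm_sub_lt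
      (by simp) hε
    obtain ⟨B, hB⟩ := s.exists_forall_norm_le
    obtain ⟨p, hp, g, hg, hgT, hgε⟩ := exists_birkhoffAverage_near_invariant hT s.measurable
      (B := B) hB hε
    -- This error function has integral at most `2 ε`. Where its maximal function stays below `lam /
    -- D`, the averages of `f` are eventually within `2 lam` of the invariant function `g`.
    set R : X → ℝ := fun x => |f x - s x| +
      |(p : ℝ)⁻¹ * ∑ k ∈ Finset.range p, s (T^[k] x) - g x| with hR
    have hRm1 : Measurable fun x => f x - s x := hf.sub s.measurable
    have hRm2 : Measurable fun x => (p : ℝ)⁻¹ * ∑ k ∈ Finset.range p, s (T^[k] x) - g x :=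
      ((Finset.measurable_fun_sum _ fun k _ =>
        s.measurable.comp (hT.iterate k).measurable).const_mul _).sub hg
    have hRm : Measurable fun x => ENNReal.ofReal (R x) :=
      ((continuous_abs.measurable.comp hRm1).add
        (continuous_abs.measurable.comp hRm2)).ennreal_ofReal
    have hRi : ∫⁻ x, ENNReal.ofReal (R x) ∂μ ≤ ε + ε := by
      have : ∀ x, ENNReal.ofReal (R x) = ‖f x - s x‖ₑ +
          ‖(p : ℝ)⁻¹ * ∑ k ∈ Finset.range p, s (T^[k] x) - g x‖ₑ := fun x => by
        rw [hR, ENNReal.ofReal_add (abs_nonneg _) (abs_nonneg _), ← Real.enorm_eq_ofReal_abs,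
          ← Real.enorm_eq_ofReal_abs]
      simp only [this]
      rw [lintegral_add_left hRm1.enorm]
      refine add_le_add ?_ hgε
      rw [eLpNorm_one_eq_lintegral_enorm] at hs
      exact hs.le
    -- The value `ε = ⊤` does occur, as the inverse of `0` in the limit above. The bound is then
    -- trivial because `C ≠ 0`: a nonempty set has the difference `0`.
    by_cases hεt : ε = ⊤
    · by_cases hC : C = 0
      · exfalso
        obtain ⟨F, hF, -⟩ := hdom y₀ le_rfl
        have h1 := hdiff F hF
        obtain ⟨a, ha⟩ := hne F hF
        have : (0 : ℤ) ∈ differenceFinset F :=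
          Finset.mem_image.2 ⟨(a, a), Finset.mem_product.2 ⟨ha, ha⟩, by simp⟩
        have := Finset.card_pos.2 ⟨_, this⟩
        rw [hC] at h1; omega
      · simp [hεt, hC, ENNReal.mul_top]
    have hmax := maximal_inequality hT hchain hne hdiff hRm
      (ne_top_of_le_ne_top (by simp [hεt]) hRi) (r := r) (by simp [hr])
    refine le_trans ?_ (hmax.trans (by gcongr))
    refine mul_le_mul' le_rfl ?_
    have hginv : ∀ᵐ x ∂μ, ∀ m, g (T^[m] x) = g x := by
      rw [ae_all_iff]
      intro m
      induction m with
      | zero => simp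
      | succ m ih =>
        filter_upwards [ih, (hT.iterate m).quasiMeasurePreserving.ae hgT] with x h1 h2
        rw [Function.iterate_succ_apply', ← h1]
        exact h2
    refine measure_mono_ae (μ := μ) ?_
    filter_upwards [hginv] with x hx hxZ
    by_contra hx2
    refine hxZ ?_
    have hx3 : ∀ F ∈ 𝓕, ∑ m ∈ F, R (T^[m] x) < lam / D * F.card := by
      intro F hF
      by_contra hcon
      refine hx2 ⟨F, hF, ?_⟩
      rw [← ENNReal.ofReal_sum_of_nonneg fun m _ => by positivity, hr,
        ← ENNReal.ofReal_natCast, ← ENNReal.ofReal_mul (by positivity)]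
      exact ENNReal.ofReal_le_ofReal (not_lt.1 hcon)
    have hlim2 : Tendsto (fun y => p * (2 * B) *
        ((((initialEnds S y).card : ℝ) + 1) / (initialPart S y).card)) atTop (𝓝 0) := by
      simpa using hends.const_mul (p * (2 * B))
    obtain ⟨Y, hY⟩ := eventually_atTop.1 ((hlim2.eventually (gt_mem_nhds hlam)).and
      (eventually_ge_atTop y₀))
    have hclose : ∀ y ≥ Y, |initialAverage S T f y x - g x| ≤ 2 * lam := by
      intro y hy
      obtain ⟨hy1, hy2⟩ := hY y hy
      have hc : (0 : ℝ) < (initialPart S y).card := by exact_mod_cast hpos y hy2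
      have h1 := abs_sum_initialPart_sub_le (S := S) (y := y) hp (f := fun m => f (T^[m] x))
        (b := fun m => s (T^[m] x)) (fun n => hB _) (g x)
      have h2 : ∑ m ∈ initialPart S y, (|f (T^[m] x) - s (T^[m] x)| +
          |(p : ℝ)⁻¹ * ∑ k ∈ Finset.range p, s (T^[m + k] x) - g x|) ≤
          lam * (initialPart S y).card := by
        obtain ⟨F, hF, hsub, hcard⟩ := hdom y hy2
        have h3 : ∑ m ∈ initialPart S y, R (T^[m] x) ≤ ∑ m ∈ F, R (T^[m] x) :=
          Finset.sum_le_sum_of_subset_of_nonneg hsub fun m _ _ => by positivity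
        have h4 : (F.card : ℝ) ≤ D * (initialPart S y).card := by exact_mod_cast hcard
        have hD' : (0 : ℝ) < D := by exact_mod_cast hD
        calc _ = ∑ m ∈ initialPart S y, R (T^[m] x) := by
              refine Finset.sum_congr rfl fun m _ => ?_
              simp only [hR, hx, ← Function.iterate_add_apply, add_comm]
          _ ≤ lam / D * F.card := h3.trans (hx3 F hF).le
          _ ≤ lam / D * (D * (initialPart S y).card) := by gcongr
          _ = _ := by field_simp
      have h5 : initialAverage S T f y x - g x =
          (∑ m ∈ initialPart S y, (f (T^[m] x) - g x)) / (initialPart S y).card := by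
        rw [initialAverage, Finset.sum_sub_distrib, Finset.sum_const, nsmul_eq_mul]
        field_simp
      rw [h5, abs_div, abs_of_pos hc, div_le_iff₀ hc]
      rw [← mul_div_assoc, div_lt_iff₀ hc] at hy1
      linarith
    refine ⟨Y, fun y hy y' hy' => ?_⟩
    have h1 := abs_le.1 (hclose y hy)
    have h2 := abs_le.1 (hclose y' hy')
    exact abs_le.2 ⟨by linarith [h1.1, h2.2], by linarith [h1.2, h2.1]⟩
  have main' : ∀ᵐ x ∂μ, ∀ n : ℕ, ∃ Y, ∀ y ≥ Y, ∀ y' ≥ Y,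
      |initialAverage S T f y x - initialAverage S T f y' x| ≤ 4 * (1 / ((n : ℝ) + 1)) :=
    ae_all_iff.2 fun n => main _ (by positivity)
  filter_upwards [main'] with x hx
  refine cauchySeq_tendsto_of_complete (Metric.cauchySeq_iff.2 fun ε hε => ?_)
  obtain ⟨n, hn⟩ := exists_nat_one_div_lt (show 0 < ε / 4 by positivity)
  obtain ⟨Y, hY⟩ := hx n
  exact ⟨Y, fun y hy y' hy' => lt_of_le_of_lt (hY y hy y' hy') (by linarith)⟩

end

/-! ### Rectangles and their difference sets -/

/-- The rectangle `{a q + b : a ≤ i, b < l}`. -/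
def rectangle (q i l : ℕ) : Finset ℕ :=
  (Finset.range (i + 1) ×ˢ Finset.range l).image fun p => p.1 * q + p.2

theorem mem_rectangle {q i l m : ℕ} :
    m ∈ rectangle q i l ↔ ∃ a b, a ≤ i ∧ b < l ∧ a * q + b = m := by
  simp only [rectangle, Finset.mem_image, Finset.mem_product, Finset.mem_range, Prod.exists]
  constructor
  · rintro ⟨a, b, ⟨h1, h2⟩, h3⟩; exact ⟨a, b, by omega, h2, h3⟩
  · rintro ⟨a, b, h1, h2, h3⟩; exact ⟨a, b, ⟨by omega, h2⟩, h3⟩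

theorem card_rectangle_le (q i l : ℕ) : (rectangle q i l).card ≤ (i + 1) * l :=
  Finset.card_image_le.trans (by simp)

theorem card_rectangle {q i l : ℕ} (hl : l ≤ q) : (rectangle q i l).card = (i + 1) * l := by
  rw [rectangle, Finset.card_image_of_injOn]
  · simp
  · rintro ⟨a, b⟩ hab ⟨a', b'⟩ hab' h
    simp only [Finset.coe_product, Finset.coe_range, Set.mem_prod, Set.mem_Iio] at hab hab' h
    have hq : 0 < q := by omega
    have h1 : (a * q + b) / q = a := by
      rw [mul_comm, Nat.mul_add_div hq, Nat.div_eq_of_lt (by omega), add_zero]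
    have h2 : (a' * q + b') / q = a' := by
      rw [mul_comm, Nat.mul_add_div hq, Nat.div_eq_of_lt (by omega), add_zero]
    have h3 : a = a' := by rw [← h1, ← h2, h]
    subst h3
    simp only [Prod.mk.injEq, true_and]
    omega

/-- Differences lie in the image of the box `[-i, i] × [-l, l]`. The constant is `6 = 2 * 3`, from
`2 i + 1 ≤ 2 (i + 1)` and `2 l + 1 ≤ 3 l`. -/
theorem card_differenceFinset_rectangle_le {q i l : ℕ} (hl : 0 < l) (hlq : l ≤ q) :
    (differenceFinset (rectangle q i l)).card ≤ 6 * (rectangle q i l).card := by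
  have hsub : differenceFinset (rectangle q i l) ⊆
      (Finset.Icc (-(i : ℤ)) i ×ˢ Finset.Icc (-(l : ℤ)) l).image fun p => p.1 * q + p.2 := by
    intro z hz
    simp only [differenceFinset, Finset.mem_image, Finset.mem_product, Prod.exists] at hz
    obtain ⟨m, n, ⟨hm, hn⟩, rfl⟩ := hz
    obtain ⟨a, b, ha, hb, rfl⟩ := mem_rectangle.1 hm
    obtain ⟨a', b', ha', hb', rfl⟩ := mem_rectangle.1 hn
    refine Finset.mem_image.2 ⟨((a : ℤ) - a', (b : ℤ) - b'), ?_, ?_⟩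
    · simp only [Finset.mem_product, Finset.mem_Icc]
      omega
    · push_cast; ring
  have h1 := (Finset.card_le_card hsub).trans Finset.card_image_le
  rw [Finset.card_product, Int.card_Icc, Int.card_Icc] at h1
  rw [card_rectangle hlq]
  have h2 : ((i : ℤ) + 1 - -(i : ℤ)).toNat = 2 * i + 1 := by omega
  have h3 : ((l : ℤ) + 1 - -(l : ℤ)).toNat = 2 * l + 1 := by omega
  rw [h2, h3] at h1
  refine h1.trans ?_
  calc (2 * i + 1) * (2 * l + 1) ≤ (2 * (i + 1)) * (3 * l) := Nat.mul_le_mul (by omega) (by omega)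
    _ = _ := by ring

theorem rectangle_mono {q i i' l l' : ℕ} (hi : i ≤ i') (hl : l ≤ l') :
    rectangle q i l ⊆ rectangle q i' l' := fun m hm => by
  obtain ⟨a, b, ha, hb, rfl⟩ := mem_rectangle.1 hm
  exact mem_rectangle.2 ⟨a, b, by omega, by omega, rfl⟩

/-! ### The block scheme and counting in its main set -/

/-- Numerical data of the sequence. In stage `s` the main set consists of intervals of length at
least `L s` starting at multiples of `Q s`, and there are `K s` additional intervals of lengths
`2 ^ j * w s`, each making up a proportion of about `1 / d s` of what precedes it. -/
structure BlockScheme where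
  d : ℕ → ℕ
  K : ℕ → ℕ
  w : ℕ → ℕ
  L : ℕ → ℕ
  Q : ℕ → ℕ
  d_pos : ∀ s, 0 < d s
  two_le_K : ∀ s, 2 ≤ K s
  w_pos : ∀ s, 0 < w s
  L_eq : ∀ s, L s = d s * w s
  dvd_Q : ∀ s, 2 * K s * 2 ^ K s * w s ∣ Q s
  mul_L_le_Q : ∀ s, 2 ^ K s * L s ≤ Q s
  two_pow_K_le : ∀ s, 2 ^ K (s + 1) ≤ Q s
  L_succ : ∀ s, L (s + 1) = Q s ^ 2

namespace BlockScheme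
variable (B : BlockScheme)

/-- The length of the `i`-th main interval in stage `s`. -/
def len (s i : ℕ) : ℕ := max (B.L s) (i + 1)

/-- The main set. -/
def mainSet : Set ℕ :=
  {m | ∃ s i, 1 ≤ i ∧ i < B.Q s ∧ i * B.Q s ≤ m ∧ m < i * B.Q s + B.len s i}

/-- The starting point of the `j`-th additional interval in stage `s`. -/
def start (s j : ℕ) : ℕ := 2 ^ j * B.Q s + (B.K s + j - 1) * (2 ^ B.K s * B.w s)

/-- The union of the additional intervals. -/
def extraSet : Set ℕ :=
  {m | ∃ s j, j < B.K s ∧ B.start s j ≤ m ∧ m < B.start s j + 2 ^ j * B.w s}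

/-- The range of the sequence. -/
def fullSet : Set ℕ := B.mainSet ∪ B.extraSet

/-- The chain of rectangles controlling the main set. -/
def family : Set (Finset ℕ) :=
  {F | ∃ s i, i < B.Q s ∧ F = rectangle (B.Q s) i (B.len s i)}

theorem L_pos (s : ℕ) : 0 < B.L s := by
  rw [B.L_eq]; exact Nat.mul_pos (B.d_pos s) (B.w_pos s)

theorem four_mul_L_le_Q (s : ℕ) : 4 * B.L s ≤ B.Q s :=
  le_trans (Nat.mul_le_mul_right _ (Nat.pow_le_pow_right (n := 2) (by norm_num) (B.two_le_K s)))
    (B.mul_L_le_Q s)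

theorem four_le_Q (s : ℕ) : 4 ≤ B.Q s := by
  have := B.four_mul_L_le_Q s; have := B.L_pos s; omega

theorem two_pow_K_le_Q (s : ℕ) : 2 ^ B.K s ≤ B.Q s :=
  le_trans (Nat.le_mul_of_pos_right _ (B.L_pos s)) (B.mul_L_le_Q s)

theorem sq_Q_lt_Q_succ (s : ℕ) : B.Q s ^ 2 < B.Q (s + 1) := by
  have := B.four_mul_L_le_Q (s + 1)
  have := B.L_pos (s + 1)
  rw [← B.L_succ]; omega

theorem Q_le_sq (s : ℕ) : B.Q s ≤ B.Q s ^ 2 := Nat.le_self_pow (by norm_num) _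

theorem Q_strictMono : StrictMono B.Q :=
  strictMono_nat_of_lt_succ fun s => (B.Q_le_sq s).trans_lt (B.sq_Q_lt_Q_succ s)

theorem sq_Q_le_L {s t : ℕ} (h : s < t) : B.Q s ^ 2 ≤ B.L t := by
  obtain ⟨t, rfl⟩ : ∃ t', t = t' + 1 := ⟨t - 1, by omega⟩
  rw [B.L_succ]
  exact Nat.pow_le_pow_left (B.Q_strictMono.monotone (by omega)) 2

theorem sq_Q_le_Q {s t : ℕ} (h : s < t) : B.Q s ^ 2 ≤ B.Q t := by
  have := B.sq_Q_le_L h; have := B.four_mul_L_le_Q t; omega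

theorem len_le_Q {s i : ℕ} (hi : i < B.Q s) : B.len s i ≤ B.Q s := by
  have := B.four_mul_L_le_Q s
  exact max_le (by omega) (by omega)

theorem len_pos (s i : ℕ) : 0 < B.len s i := lt_of_lt_of_le (B.L_pos s) (le_max_left _ _)

theorem mul_Q_add_len_le {s i : ℕ} (hi : i < B.Q s) :
    i * B.Q s + B.len s i ≤ (i + 1) * B.Q s := by
  have := B.len_le_Q hi
  rw [add_mul]; omega

theorem succ_mul_Q_le_sq {s i : ℕ} (hi : i < B.Q s) : (i + 1) * B.Q s ≤ B.Q s ^ 2 := by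
  rw [pow_two]; exact Nat.mul_le_mul_right _ hi

theorem family_nonempty : ∀ F ∈ B.family, F.Nonempty := by
  rintro F ⟨s, i, -, rfl⟩
  exact ⟨0, mem_rectangle.2 ⟨0, 0, Nat.zero_le _, B.len_pos s i, by simp⟩⟩

theorem family_difference : ∀ F ∈ B.family, (differenceFinset F).card ≤ 6 * F.card := by
  rintro F ⟨s, i, hi, rfl⟩
  exact card_differenceFinset_rectangle_le (B.len_pos s i) (B.len_le_Q hi)

/-- All of stage `s` lies below `Q s ^ 2 ≤ L t`, hence in the first row of any rectangle of a later
stage. -/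
theorem rectangle_subset_rectangle {s t i j : ℕ} (hst : s < t) (hi : i < B.Q s) :
    rectangle (B.Q s) i (B.len s i) ⊆ rectangle (B.Q t) j (B.len t j) := by
  intro m hm
  obtain ⟨a, b, ha, hb, rfl⟩ := mem_rectangle.1 hm
  refine mem_rectangle.2 ⟨0, a * B.Q s + b, Nat.zero_le _, ?_, by simp⟩
  have h1 := B.len_le_Q hi
  have h2 := B.succ_mul_Q_le_sq hi
  have h3 := B.sq_Q_le_L hst
  have h4 : B.L t ≤ B.len t j := le_max_left _ _
  have h5 : a * B.Q s ≤ i * B.Q s := Nat.mul_le_mul_right _ ha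
  rw [add_mul] at h2
  omega

theorem family_isChain : IsChain (· ⊆ ·) B.family := by
  rintro F ⟨s, i, hi, rfl⟩ G ⟨t, j, hj, rfl⟩ -
  rcases lt_trichotomy s t with h | rfl | h
  · exact Or.inl (B.rectangle_subset_rectangle h hi)
  · rcases le_total i j with h | h
    · exact Or.inl (rectangle_mono h (max_le_max le_rfl (by omega)))
    · exact Or.inr (rectangle_mono h (max_le_max le_rfl (by omega)))
  · exact Or.inr (B.rectangle_subset_rectangle h hj)

/-- `y` lies in the part of stage `s` that comes after the first `i` main intervals have started
and before the next one starts. -/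
structure Located (y s i : ℕ) : Prop where
  one_le_s : 1 ≤ s
  one_le_i : 1 ≤ i
  i_lt : i < B.Q s
  le_y : i * B.Q s ≤ y
  y_lt : y < B.Q (s + 1)
  y_le : y ≤ (i + 1) * B.Q s ∨ i + 1 = B.Q s

theorem le_Q (n : ℕ) : n ≤ B.Q n := B.Q_strictMono.id_le n

theorem exists_located {t y : ℕ} (ht : 1 ≤ t) (hy : B.Q t ≤ y) :
    ∃ s i, t ≤ s ∧ B.Located y s i := by
  obtain ⟨s, hs1, hs2⟩ : ∃ s, B.Q s ≤ y ∧ y < B.Q (s + 1) := by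
    have hne : ∃ n, y < B.Q n := ⟨y + 1, lt_of_lt_of_le (Nat.lt_succ_self y) (B.le_Q _)⟩
    have h1 := Nat.find_spec hne
    have h0 : Nat.find hne ≠ 0 := fun h => by
      rw [h] at h1
      have := B.Q_strictMono.monotone (Nat.zero_le t)
      omega
    obtain ⟨s, hs⟩ := Nat.exists_eq_succ_of_ne_zero h0
    refine ⟨s, ?_, ?_⟩
    · exact not_lt.1 (Nat.find_min hne (by omega))
    · rw [hs] at h1; exact h1
  have hts : t ≤ s := by
    by_contra h
    have := B.Q_strictMono.monotone (show s + 1 ≤ t by omega)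
    omega
  have hQ := B.four_le_Q s
  rcases lt_or_ge (y / B.Q s) (B.Q s) with h | h
  · refine ⟨s, y / B.Q s, hts, by omega, (Nat.one_le_div_iff (by omega)).2 hs1, h,
      Nat.div_mul_le_self _ _, hs2, Or.inl ?_⟩
    have := Nat.lt_div_mul_add (a := y) (show 0 < B.Q s by omega)
    rw [add_mul]; omega
  · refine ⟨s, B.Q s - 1, hts, by omega, by omega, by omega, ?_, hs2, Or.inr (by omega)⟩
    have h1 : B.Q s * B.Q s ≤ y := (Nat.le_div_iff_mul_le (by omega)).1 h
    exact le_trans (Nat.mul_le_mul_right _ (by omega)) h1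

theorem initialPart_mainSet_subset {y s i : ℕ} (hi : i < B.Q s) (hy : y < B.Q (s + 1))
    (hyi : y ≤ (i + 1) * B.Q s ∨ i + 1 = B.Q s) :
    initialPart B.mainSet y ⊆ rectangle (B.Q s) i (B.len s i) := by
  intro m hm
  obtain ⟨hmy, t, a, ha1, ha2, ha3, ha4⟩ := mem_initialPart.1 hm
  rcases lt_trichotomy t s with h | rfl | h
  · have h1 := B.mul_Q_add_len_le ha2
    have h2 := B.succ_mul_Q_le_sq ha2
    have h3 := B.sq_Q_le_L h
    have h4 : B.L s ≤ B.len s i := le_max_left _ _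
    exact mem_rectangle.2 ⟨0, m, Nat.zero_le _, by omega, by simp⟩
  · have hai : a ≤ i := by
      rcases hyi with h | h
      · have : a * B.Q t < (i + 1) * B.Q t := by omega
        have := lt_of_mul_lt_mul_right this (Nat.zero_le _)
        omega
      · omega
    have : B.len t a ≤ B.len t i := max_le_max le_rfl (by omega)
    exact mem_rectangle.2 ⟨a, m - a * B.Q t, hai, by omega, by omega⟩
  · exfalso
    have h1 := B.Q_strictMono.monotone (show s + 1 ≤ t by omega)
    have h2 : B.Q t ≤ a * B.Q t := Nat.le_mul_of_pos_left _ ha1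
    omega

theorem initialPart_mono (S : Set ℕ) {y z : ℕ} (h : y ≤ z) : initialPart S y ⊆ initialPart S z :=
  fun m hm => by
    rw [mem_initialPart] at hm ⊢
    exact ⟨by omega, hm.2⟩

/-- Induction on `i`, adding one main interval at a time. The lengths grow at least like `i`, so the
stage has filled a positive proportion of `[0, Q s ^ 2)` when it ends. -/
theorem le_card_initialPart_mul_Q (s : ℕ) {i : ℕ} (hi1 : 1 ≤ i) (hi : i ≤ B.Q s) :
    (i - 1) * max (B.L s) i ≤ 2 * (initialPart B.mainSet (i * B.Q s)).card := by
  induction i, hi1 using Nat.le_induction with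
  | base => simp
  | succ i hi1 ih =>
    have ih := ih (by omega)
    have hlen := B.mul_Q_add_len_le (show i < B.Q s by omega)
    have hdisj : Disjoint (initialPart B.mainSet (i * B.Q s))
        (Finset.Ico (i * B.Q s) (i * B.Q s + B.len s i)) := by
      rw [Finset.disjoint_left]
      intro m hm hm'
      rw [mem_initialPart] at hm
      rw [Finset.mem_Ico] at hm'
      omega
    have hsub : initialPart B.mainSet (i * B.Q s) ∪
        Finset.Ico (i * B.Q s) (i * B.Q s + B.len s i) ⊆
        initialPart B.mainSet ((i + 1) * B.Q s) := by
      refine Finset.union_subset (initialPart_mono _ (by omega)) fun m hm => ?_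
      rw [Finset.mem_Ico] at hm
      exact mem_initialPart.2 ⟨by omega, s, i, hi1, by omega, hm.1, hm.2⟩
    have hcard := Finset.card_le_card hsub
    rw [Finset.card_union_of_disjoint hdisj, Nat.card_Ico, Nat.add_sub_cancel_left] at hcard
    have h2 : (i + 1 - 1) * max (B.L s) (i + 1) ≤ (i - 1) * max (B.L s) i + 2 * B.len s i := by
      obtain ⟨j, rfl⟩ : ∃ j, i = j + 1 := ⟨i - 1, by omega⟩
      simp only [Nat.add_sub_cancel, len]
      rcases le_total (B.L s) (j + 1 + 1) with h | h
      · rw [max_eq_right h]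
        have : j * (j + 1) ≤ j * max (B.L s) (j + 1) := Nat.mul_le_mul_left _ (le_max_right _ _)
        nlinarith
      · rw [max_eq_left h, max_eq_left (by omega)]
        nlinarith
    omega

/-- The preceding stage ends at `Q ^ 2 = L s` with positive density. So the first row of the next
rectangle is already well filled when a new stage begins. -/
theorem L_le_card_initialPart {s : ℕ} (hs : 1 ≤ s) :
    B.L s ≤ 4 * (initialPart B.mainSet (B.L s)).card := by
  obtain ⟨s, rfl⟩ : ∃ t, s = t + 1 := ⟨s - 1, by omega⟩
  have h := B.le_card_initialPart_mul_Q s (i := B.Q s) (by have := B.four_le_Q s; omega) le_rfl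
  rw [← pow_two, ← B.L_succ] at h
  have h1 : (B.Q s - 1) * B.Q s ≤ (B.Q s - 1) * max (B.L s) (B.Q s) :=
    Nat.mul_le_mul_left _ (le_max_right _ _)
  have h2 := B.four_le_Q s
  have h3 : B.L (s + 1) ≤ 2 * ((B.Q s - 1) * B.Q s) := by
    rw [B.L_succ, pow_two, ← mul_assoc]
    exact Nat.mul_le_mul_right _ (by omega)
  omega

/-- For `i = 1` there may be no point of stage `s` below `y` yet, and the earlier stages supply all
the points. For larger `i` the main intervals of stage `s` suffice. -/
theorem Located.card_le {B : BlockScheme} {y s i : ℕ} (h : B.Located y s i) :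
    (i + 1) * B.len s i ≤ 16 * (initialPart B.mainSet y).card := by
  have h1 := Finset.card_le_card (initialPart_mono B.mainSet h.le_y)
  have hi := h.one_le_i
  have hQ : B.L s ≤ y := by
    have h2 := B.four_mul_L_le_Q s
    have h3 : B.Q s ≤ i * B.Q s := Nat.le_mul_of_pos_left _ hi
    have := h.le_y
    omega
  have h4 := Finset.card_le_card (initialPart_mono B.mainSet hQ)
  have h5 := B.L_le_card_initialPart h.one_le_s
  have hL : 16 ≤ B.L s := by
    have h6 := B.sq_Q_le_L (show s - 1 < s by have := h.one_le_s; omega)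
    have h7 := B.four_le_Q (s - 1)
    nlinarith
  rcases Nat.lt_or_ge i 2 with hi2 | hi2
  · obtain rfl : i = 1 := by omega
    rw [len, max_eq_left (by omega)]
    omega
  · have h6 := B.le_card_initialPart_mul_Q s hi h.i_lt.le
    have h7 : B.len s i ≤ 2 * max (B.L s) i := by
      rw [len]; omega
    calc (i + 1) * B.len s i ≤ (3 * (i - 1)) * (2 * max (B.L s) i) :=
          Nat.mul_le_mul (by omega) h7
      _ = 6 * ((i - 1) * max (B.L s) i) := by ring
      _ ≤ _ := by omega

theorem mainSet_dominated : ∀ y ≥ B.Q 1, ∃ F ∈ B.family, initialPart B.mainSet y ⊆ F ∧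
    F.card ≤ 16 * (initialPart B.mainSet y).card := by
  intro y hy
  obtain ⟨s, i, -, h⟩ := B.exists_located le_rfl hy
  exact ⟨_, ⟨s, i, h.i_lt, rfl⟩, B.initialPart_mainSet_subset h.i_lt h.y_lt h.y_le,
    (card_rectangle_le _ _ _).trans h.card_le⟩

theorem ends_in_stage {m s : ℕ} (hm : m ∈ B.mainSet) (hm' : m + 1 ∉ B.mainSet)
    (h1 : B.Q s ≤ m) (h2 : m < B.Q (s + 1)) :
    ∃ a, a < B.Q s ∧ a * B.Q s ≤ m ∧ a * B.Q s + B.len s a - 1 = m := by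
  obtain ⟨t, a, ha1, ha2, ha3, ha4⟩ := hm
  rcases lt_trichotomy t s with h | rfl | h
  · have h3 := B.mul_Q_add_len_le ha2
    have h4 := B.succ_mul_Q_le_sq ha2
    have h5 := B.sq_Q_le_Q h
    omega
  · refine ⟨a, ha2, ha3, ?_⟩
    by_contra hne
    exact hm' ⟨t, a, ha1, ha2, by omega, by omega⟩
  · have h3 := B.Q_strictMono.monotone (show s + 1 ≤ t by omega)
    have h4 : B.Q t ≤ a * B.Q t := Nat.le_mul_of_pos_left _ ha1
    omega

/-- Intervals of stage `t + 1` have length at least `Q t ^ 2` and contribute at most `i + 1` ends,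
while everything earlier contributes at most `2 * Q t`. The proportion of ends is therefore `O(1 / Q
t)`. -/
theorem Located.ends_le {B : BlockScheme} {y t i : ℕ} (h : B.Located y (t + 1) i) :
    ((initialEnds B.mainSet y).card + 1) * B.Q t ≤ 64 * (initialPart B.mainSet y).card := by
  have hsub : initialEnds B.mainSet y ⊆ (Finset.range (B.Q t) ∪
      (Finset.range (B.Q t)).image (fun a => a * B.Q t + B.len t a - 1)) ∪
      (Finset.range (i + 1)).image fun a => a * B.Q (t + 1) + B.len (t + 1) a - 1 := by
    intro m hm
    obtain ⟨hmy, hm1, hm2⟩ := mem_initialEnds.1 hm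
    simp only [Finset.mem_union, Finset.mem_range, Finset.mem_image]
    rcases lt_or_ge m (B.Q t) with h1 | h1
    · exact Or.inl (Or.inl h1)
    rcases lt_or_ge m (B.Q (t + 1)) with h2 | h2
    · obtain ⟨a, ha, -, hma⟩ := B.ends_in_stage hm1 hm2 h1 h2
      exact Or.inl (Or.inr ⟨a, ha, hma⟩)
    · obtain ⟨a, ha, ham, hma⟩ := B.ends_in_stage hm1 hm2 h2 (by have := h.y_lt; omega)
      refine Or.inr ⟨a, ?_, hma⟩
      rcases h.y_le with h3 | h3
      · exact lt_of_mul_lt_mul_right (show a * B.Q (t + 1) < (i + 1) * B.Q (t + 1) by omega)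
          (Nat.zero_le _)
      · omega
  have hc1 : (initialEnds B.mainSet y).card ≤ B.Q t + B.Q t + (i + 1) := by
    refine (Finset.card_le_card hsub).trans ((Finset.card_union_le _ _).trans ?_)
    refine add_le_add ((Finset.card_union_le _ _).trans (add_le_add (by simp) ?_)) ?_
    · exact Finset.card_image_le.trans (by simp)
    · exact Finset.card_image_le.trans (by simp)
  have hc2 := h.card_le
  have hc3 : (i + 1) * B.Q t ^ 2 ≤ (i + 1) * B.len (t + 1) i := by
    rw [← B.L_succ]; exact Nat.mul_le_mul_left _ (le_max_left _ _)
  have hQ := B.four_le_Q t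
  have hc4 : (initialEnds B.mainSet y).card + 1 ≤ 4 * ((i + 1) * B.Q t) := by nlinarith
  calc _ ≤ 4 * ((i + 1) * B.Q t) * B.Q t := Nat.mul_le_mul_right _ hc4
    _ = 4 * ((i + 1) * B.Q t ^ 2) := by ring
    _ ≤ _ := by omega

theorem card_initialPart_mainSet_pos {y : ℕ} (hy : B.Q 1 ≤ y) :
    0 < (initialPart B.mainSet y).card := by
  obtain ⟨F, hF, -, h⟩ := B.mainSet_dominated y hy
  have := (B.family_nonempty F hF).card_pos
  omega

theorem tendsto_ends : Tendsto (fun y => (((initialEnds B.mainSet y).card : ℝ) + 1) /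
    (initialPart B.mainSet y).card) atTop (𝓝 0) := by
  rw [Metric.tendsto_atTop]
  intro ε hε
  obtain ⟨n, hn⟩ := exists_nat_gt (64 / ε)
  refine ⟨B.Q (n + 1), fun y hy => ?_⟩
  obtain ⟨s, i, hs, h⟩ := B.exists_located (by omega) hy
  obtain ⟨t, rfl⟩ : ∃ t, s = t + 1 := ⟨s - 1, by omega⟩
  have h1 := h.ends_le
  have h2 := B.card_initialPart_mainSet_pos
    ((B.Q_strictMono.monotone (show 1 ≤ n + 1 by omega)).trans hy)
  have h3 : n ≤ B.Q t := le_trans (by omega) (B.le_Q t)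
  have h1' : (((initialEnds B.mainSet y).card : ℝ) + 1) * B.Q t ≤
      64 * (initialPart B.mainSet y).card := by exact_mod_cast h1
  have h2' : (0 : ℝ) < (initialPart B.mainSet y).card := by exact_mod_cast h2
  have h3' : (n : ℝ) ≤ B.Q t := by exact_mod_cast h3
  rw [dist_zero_right, Real.norm_of_nonneg (by positivity), div_lt_iff₀ h2']
  rw [div_lt_iff₀ hε] at hn
  have h4 : 64 < B.Q t * ε := by nlinarith
  have hE : (0 : ℝ) < ((initialEnds B.mainSet y).card : ℝ) + 1 := by positivity
  have hQ : (0 : ℝ) < B.Q t := by have := B.four_le_Q t; positivity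
  by_contra hcon
  push Not at hcon
  have h5 := mul_le_mul_of_nonneg_right hcon hQ.le
  nlinarith [mul_pos h2' (sub_pos.2 h4)]

end BlockScheme

/-! ### Counting the additional intervals -/

theorem sum_biUnion_le {ι : Type*} [DecidableEq ι] (I : Finset ι) (t : ι → Finset ℕ) {g : ℕ → ℝ}
    (hg : ∀ n, 0 ≤ g n) : ∑ m ∈ I.biUnion t, g m ≤ ∑ p ∈ I, ∑ m ∈ t p, g m := by
  induction I using Finset.induction_on with
  | empty => simp
  | insert a I ha ih =>
    rw [Finset.biUnion_insert, Finset.sum_insert ha]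
    have h1 := Finset.sum_union_inter (s₁ := t a) (s₂ := I.biUnion t) (f := g)
    have h2 : 0 ≤ ∑ m ∈ t a ∩ I.biUnion t, g m := Finset.sum_nonneg fun m _ => hg m
    linarith

namespace BlockScheme
variable (B : BlockScheme)

theorem Q_le_start (s j : ℕ) : 2 ^ j * B.Q s ≤ B.start s j := Nat.le_add_right _ _

/-- The additional intervals starting before `y`. -/
def activeBlocks (y : ℕ) : Finset (ℕ × ℕ) :=
  (Finset.range y ×ˢ Finset.range y).filter fun p => p.2 < B.K p.1 ∧ B.start p.1 p.2 < y

theorem mem_activeBlocks {y : ℕ} {p : ℕ × ℕ} :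
    p ∈ B.activeBlocks y ↔ p.2 < B.K p.1 ∧ B.start p.1 p.2 < y := by
  simp only [activeBlocks, Finset.mem_filter, Finset.mem_product, Finset.mem_range,
    and_iff_right_iff_imp]
  rintro ⟨-, h⟩
  have h1 := B.Q_le_start p.1 p.2
  have h2 := B.le_Q p.1
  have h3 := B.four_le_Q p.1
  have h4 : p.2 < 2 ^ p.2 := Nat.lt_two_pow_self
  constructor
  · have : B.Q p.1 ≤ 2 ^ p.2 * B.Q p.1 := Nat.le_mul_of_pos_left _ (by positivity)
    omega
  · have : 2 ^ p.2 ≤ 2 ^ p.2 * B.Q p.1 := Nat.le_mul_of_pos_right _ (by omega)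
    omega

theorem sum_two_pow_le (n : ℕ) : ∑ j ∈ Finset.range n, 2 ^ j ≤ 2 ^ n := by
  have := Nat.geomSum_lt (m := 2) (n := n) (s := Finset.range n) le_rfl (by simp)
  exact this.le

theorem sum_Q_le {s : ℕ} (hs : 1 ≤ s) : ∑ t ∈ Finset.range s, B.Q t ≤ B.L s := by
  induction s, hs using Nat.le_induction with
  | base => simpa [B.L_succ] using B.Q_le_sq 0
  | succ s hs ih =>
    rw [Finset.sum_range_succ, B.L_succ]
    have h1 := B.four_mul_L_le_Q s
    have h2 := B.four_le_Q s
    nlinarith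

/-- Earlier stages contribute at most `∑ Q t ≤ L s`. In stage `s` only those `j` with `2 ^ j ≤ i`
are active, and their lengths form a geometric series. -/
theorem sum_activeBlocks_le {y s i : ℕ} (hs : 1 ≤ s) (hi1 : 1 ≤ i) (hi : i < B.Q s)
    (hy : y < B.Q (s + 1)) (hyi : y ≤ (i + 1) * B.Q s ∨ i + 1 = B.Q s) :
    ∑ p ∈ B.activeBlocks y, 2 ^ p.2 * B.L p.1 ≤ B.L s + 2 * i * B.L s := by
  set I := ((Finset.range s).sigma fun t => Finset.range (B.K t)).image
    (fun p => ((p.1, p.2) : ℕ × ℕ)) with hI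
  set J := (Finset.range (Nat.log 2 i + 1)).image (fun j => (s, j)) with hJ
  have hsub : B.activeBlocks y ⊆ I ∪ J := by
    rintro ⟨t, j⟩ hp
    obtain ⟨hj, hc⟩ := B.mem_activeBlocks.1 hp
    have h1 := B.Q_le_start t j
    simp only at hj hc
    rw [Finset.mem_union]
    rcases lt_trichotomy t s with h | rfl | h
    · refine Or.inl (Finset.mem_image.2 ⟨⟨t, j⟩, ?_, rfl⟩)
      simpa using ⟨h, hj⟩
    · refine Or.inr (Finset.mem_image.2 ⟨j, Finset.mem_range.2 (Nat.lt_succ_of_le ?_), rfl⟩)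
      refine Nat.le_log_of_pow_le (by norm_num) ?_
      rcases hyi with h | h
      · have : 2 ^ j * B.Q t < (i + 1) * B.Q t := by omega
        have := lt_of_mul_lt_mul_right this (Nat.zero_le _)
        omega
      · have h2 : 2 ^ j < 2 ^ B.K t := Nat.pow_lt_pow_right (by norm_num) hj
        have := B.two_pow_K_le_Q t
        omega
    · exfalso
      have h2 := B.Q_strictMono.monotone (show s + 1 ≤ t by omega)
      have : B.Q t ≤ 2 ^ j * B.Q t := Nat.le_mul_of_pos_left _ (by positivity)
      omega
  have hsI : ∑ p ∈ I, 2 ^ p.2 * B.L p.1 ≤ B.L s := by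
    rw [hI, Finset.sum_image, Finset.sum_sigma]
    · refine le_trans (Finset.sum_le_sum fun t _ => ?_) (B.sum_Q_le hs)
      simp only
      rw [← Finset.sum_mul]
      exact le_trans (Nat.mul_le_mul_right _ (sum_two_pow_le _)) (B.mul_L_le_Q t)
    · rintro ⟨a, b⟩ - ⟨c, d⟩ - h
      simp only [Prod.mk.injEq] at h
      obtain ⟨rfl, rfl⟩ := h
      rfl
  have hsJ : ∑ p ∈ J, 2 ^ p.2 * B.L p.1 ≤ 2 * i * B.L s := by
    rw [hJ, Finset.sum_image fun a _ b _ h => by simpa using h]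
    simp only
    rw [← Finset.sum_mul]
    refine Nat.mul_le_mul_right _ ((sum_two_pow_le _).trans ?_)
    rw [pow_succ, mul_comm]
    exact Nat.mul_le_mul_left _ (Nat.pow_log_le_self 2 (by omega))
  calc _ ≤ ∑ p ∈ I ∪ J, 2 ^ p.2 * B.L p.1 := Finset.sum_le_sum_of_subset hsub
    _ ≤ ∑ p ∈ I ∪ J, 2 ^ p.2 * B.L p.1 + ∑ p ∈ I ∩ J, 2 ^ p.2 * B.L p.1 := Nat.le_add_right _ _
    _ = ∑ p ∈ I, 2 ^ p.2 * B.L p.1 + ∑ p ∈ J, 2 ^ p.2 * B.L p.1 := Finset.sum_union_inter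
    _ ≤ _ := add_le_add hsI hsJ

theorem sum_activeBlocks_le_card {y : ℕ} (hy : B.Q 1 ≤ y) :
    ∑ p ∈ B.activeBlocks y, 2 ^ p.2 * B.L p.1 ≤ 32 * (initialPart B.mainSet y).card := by
  obtain ⟨s, i, -, h⟩ := B.exists_located le_rfl hy
  have h1 := B.sum_activeBlocks_le h.one_le_s h.one_le_i h.i_lt h.y_lt h.y_le
  have h2 := h.card_le
  have h3 : (i + 1) * B.L s ≤ (i + 1) * B.len s i := Nat.mul_le_mul_left _ (le_max_left _ _)
  have h4 : B.L s + 2 * i * B.L s ≤ 2 * ((i + 1) * B.L s) := by nlinarith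
  omega

theorem initialPart_extraSet_subset (y : ℕ) :
    initialPart B.extraSet y ⊆ (B.activeBlocks y).biUnion fun p =>
      (Finset.range (2 ^ p.2 * B.w p.1)).image fun l => B.start p.1 p.2 + l := by
  intro m hm
  obtain ⟨hmy, s, j, hj, h1, h2⟩ := mem_initialPart.1 hm
  refine Finset.mem_biUnion.2 ⟨(s, j), B.mem_activeBlocks.2 ⟨hj, by simp only; omega⟩, ?_⟩
  exact Finset.mem_image.2 ⟨m - B.start s j, Finset.mem_range.2 (by simp only; omega),
    by simp only; omega⟩

/-- The sum of a nonnegative function over the additional points is bounded by its sum over the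
active intervals. -/
theorem sum_initialPart_extraSet_le (y : ℕ) {g : ℕ → ℝ} (hg : ∀ n, 0 ≤ g n) :
    ∑ m ∈ initialPart B.extraSet y, g m ≤
      ∑ p ∈ B.activeBlocks y, ∑ l ∈ Finset.range (2 ^ p.2 * B.w p.1), g (B.start p.1 p.2 + l) := by
  refine (Finset.sum_le_sum_of_subset_of_nonneg (B.initialPart_extraSet_subset y)
    fun m _ _ => hg m).trans ?_
  refine (sum_biUnion_le _ _ hg).trans (le_of_eq (Finset.sum_congr rfl fun p _ => ?_))
  rw [Finset.sum_image fun a _ b _ h => by simpa using h]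

theorem start_add_le (s : ℕ) {j : ℕ} (hj : j < B.K s) :
    B.start s j + 2 ^ j * B.w s ≤ (2 ^ j + 1) * B.Q s := by
  have hK := B.two_le_K s
  have h1 : 2 * B.K s * 2 ^ B.K s * B.w s ≤ B.Q s :=
    Nat.le_of_dvd (by have := B.four_le_Q s; omega) (B.dvd_Q s)
  have h2 : 2 ^ j * B.w s ≤ 2 ^ B.K s * B.w s :=
    Nat.mul_le_mul_right _ (Nat.pow_le_pow_right (by norm_num) hj.le)
  have h3 : (B.K s + j - 1) * (2 ^ B.K s * B.w s) + 2 ^ B.K s * B.w s =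
      (B.K s + j) * (2 ^ B.K s * B.w s) := by
    conv_rhs => rw [show B.K s + j = (B.K s + j - 1) + 1 by omega, add_mul, one_mul]
  have h4 : (B.K s + j) * (2 ^ B.K s * B.w s) ≤ 2 * B.K s * (2 ^ B.K s * B.w s) :=
    Nat.mul_le_mul_right _ (by omega)
  rw [start, add_mul, one_mul]
  rw [mul_assoc (2 * B.K s)] at h1
  omega

/-- At the end of the `j`-th additional interval the main set has at most `(2 ^ j + 1) * L s` points
and the additional ones number at most `(1 + 2 * 2 ^ j) * L s`. Thus the interval keeps a proportion
of at least `1 / (5 * d s)`. -/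
theorem card_initialPart_fullSet_le {s j : ℕ} (hs : 1 ≤ s) (hj : j < B.K s) :
    (initialPart B.fullSet (B.start s j + 2 ^ j * B.w s)).card ≤ 5 * (2 ^ j * B.L s) := by
  classical
  set y := B.start s j + 2 ^ j * B.w s with hy
  obtain ⟨t, rfl⟩ : ∃ t, s = t + 1 := ⟨s - 1, by omega⟩
  have hyle := B.start_add_le (t + 1) hj
  have hjK : 2 ^ j < 2 ^ B.K (t + 1) := Nat.pow_lt_pow_right (by norm_num) hj
  have hiQ : 2 ^ j < B.Q (t + 1) := hjK.trans_le (B.two_pow_K_le_Q _)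
  have hL : 2 ^ j + 1 ≤ B.L (t + 1) := by
    have h1 := B.two_pow_K_le t
    have h2 := B.Q_le_sq t
    rw [B.L_succ]; omega
  have hylt : y < B.Q (t + 1 + 1) := by
    have h1 := B.succ_mul_Q_le_sq hiQ
    have h2 := B.sq_Q_lt_Q_succ (t + 1)
    omega
  have hmain := (Finset.card_le_card (B.initialPart_mainSet_subset hiQ hylt (Or.inl hyle))).trans
    (card_rectangle_le _ _ _)
  rw [len, max_eq_left hL] at hmain
  have hact := B.sum_activeBlocks_le hs Nat.one_le_two_pow hiQ hylt (Or.inl hyle)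
  have hex : (initialPart B.extraSet y).card ≤ ∑ p ∈ B.activeBlocks y, 2 ^ p.2 * B.L p.1 := by
    refine (Finset.card_le_card (B.initialPart_extraSet_subset y)).trans
      (Finset.card_biUnion_le.trans (Finset.sum_le_sum fun p _ => ?_))
    refine Finset.card_image_le.trans ?_
    rw [Finset.card_range, B.L_eq]
    exact Nat.mul_le_mul_left _ (Nat.le_mul_of_pos_left _ (B.d_pos _))
  have hfull : initialPart B.fullSet y ⊆ initialPart B.mainSet y ∪ initialPart B.extraSet y := by
    intro m hm
    rw [mem_initialPart] at hm
    rw [Finset.mem_union, mem_initialPart, mem_initialPart]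
    exact hm.2.imp (fun h => ⟨hm.1, h⟩) fun h => ⟨hm.1, h⟩
  have := (Finset.card_le_card hfull).trans (Finset.card_union_le _ _)
  have h5 : 1 ≤ 2 ^ j := Nat.one_le_two_pow
  nlinarith [B.L_pos (t + 1)]

theorem zero_notMem_fullSet : 0 ∉ B.fullSet := by
  rintro (⟨s, i, hi, -, h, -⟩ | ⟨s, j, -, h, -⟩)
  · have := B.four_le_Q s
    have : 0 < i * B.Q s := Nat.mul_pos hi (by omega)
    omega
  · have h1 := B.Q_le_start s j
    have := B.four_le_Q s
    have : 0 < 2 ^ j * B.Q s := Nat.mul_pos (by positivity) (by omega)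
    omega

theorem infinite_fullSet : B.fullSet.Infinite := by
  rw [Set.infinite_iff_exists_gt]
  intro n
  have h4 := B.four_le_Q (n + 1)
  have h := B.le_Q (n + 1)
  refine ⟨1 * B.Q (n + 1), Or.inl ⟨n + 1, 1, le_rfl, by omega, le_rfl, ?_⟩, by omega⟩
  have := B.len_pos (n + 1) 1
  omega

end BlockScheme

/-! ### Gauge functions and enumeration of sets -/

theorem IsGauge.monotone {φ : ℝ → ℝ} (h : IsGauge φ) : Monotone φ := by
  intro x y hxy
  rcases le_total y 1 with hy | hy
  · rw [h.eq_one x (hxy.trans hy), h.eq_one y hy]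
  · rcases le_total x 1 with hx | hx
    · rw [h.eq_one x hx, ← h.eq_one 1 le_rfl]
      exact h.strictMonoOn.monotoneOn (Set.mem_Ici.2 le_rfl) hy hy
    · exact h.strictMonoOn.monotoneOn hx hy hxy

theorem IsGauge.one_le {φ : ℝ → ℝ} (h : IsGauge φ) (x : ℝ) : 1 ≤ φ x := by
  rw [← h.eq_one (min x 1) (min_le_right _ _)]
  exact h.monotone (min_le_left _ _)

section enumeration
variable {X : Type u} {T : X → X} {S : Set ℕ}

/-- The increasing enumeration of a set of natural numbers. -/
noncomputable def enumeration (S : Set ℕ) : ℕ → ℕ := Nat.nth fun m => m ∈ S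

theorem enumeration_strictMono (hS : S.Infinite) : StrictMono (enumeration S) :=
  Nat.nth_strictMono hS

theorem enumeration_mem (hS : S.Infinite) (n : ℕ) : enumeration S n ∈ S :=
  Nat.nth_mem_of_infinite hS n

open Classical in
theorem card_initialPart_eq_count (S : Set ℕ) (y : ℕ) :
    (initialPart S y).card = Nat.count (fun m => m ∈ S) y := by
  rw [Nat.count_eq_card_filter_range, initialPart]

theorem initialPart_eq_image (hS : S.Infinite) (y : ℕ) :
    initialPart S y = (Finset.range (initialPart S y).card).image (enumeration S) := by
  classical
  ext m
  rw [mem_initialPart, Finset.mem_image, card_initialPart_eq_count]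
  constructor
  · rintro ⟨h1, h2⟩
    exact ⟨Nat.count (fun m => m ∈ S) m, Finset.mem_range.2 (Nat.count_strict_mono h2 h1),
      Nat.nth_count h2⟩
  · rintro ⟨n, hn, rfl⟩
    exact ⟨Nat.nth_lt_of_lt_count (Finset.mem_range.1 hn), enumeration_mem hS n⟩

theorem sum_range_enumeration (hS : S.Infinite) (g : ℕ → ℝ) (y : ℕ) :
    ∑ n ∈ Finset.range (initialPart S y).card, g (enumeration S n) =
      ∑ m ∈ initialPart S y, g m := by
  conv_rhs => rw [initialPart_eq_image hS y]
  rw [Finset.sum_image fun a _ b _ h => (enumeration_strictMono hS).injective h]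

theorem ergodicAverage_card_eq (hS : S.Infinite) (f : X → ℝ) (y : ℕ) (x : X) :
    ergodicAverage (enumeration S) T f (initialPart S y).card x = initialAverage S T f y x := by
  rw [ergodicAverage, sum_range_enumeration hS (fun m => f (T^[m] x)), initialAverage]
  ring

theorem ergodicAverage_enumeration_eq (hS : S.Infinite) (f : X → ℝ) (N : ℕ) (x : X) :
    ergodicAverage (enumeration S) T f N x = initialAverage S T f (enumeration S N) x := by
  classical
  have : (initialPart S (enumeration S N)).card = N := by
    rw [card_initialPart_eq_count]
    exact Nat.count_nth_of_infinite (p := fun m => m ∈ S) hS N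
  rw [← ergodicAverage_card_eq hS, this]

end enumeration

/-! ### Convergence along the full set -/

namespace BlockScheme
variable (B : BlockScheme)

/-- The sum of `g` over the `p.2`-th additional interval of stage `p.1`. -/
noncomputable def blockSum (g : ℕ → ℝ) (p : ℕ × ℕ) : ℝ :=
  ∑ l ∈ Finset.range (2 ^ p.2 * B.w p.1), g (B.start p.1 p.2 + l)

/-- For each threshold, finitely many bad intervals contribute a bounded total. The others
contribute a small multiple of `∑ 2 ^ j * L s`, which is comparable to the size of the main set. -/
theorem tendsto_extra {g : ℕ → ℝ} (hg : ∀ n, 0 ≤ g n)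
    (hfin : ∀ n : ℕ, {p : ℕ × ℕ | p.2 < B.K p.1 ∧
      1 / ((n : ℝ) + 1) * (2 ^ p.2 * B.L p.1 : ℕ) < B.blockSum g p}.Finite) :
    Tendsto (fun y => (∑ m ∈ initialPart B.extraSet y, g m) / (initialPart B.mainSet y).card)
      atTop (𝓝 0) := by
  rw [Metric.tendsto_atTop]
  intro ε hε
  obtain ⟨n, hn⟩ := exists_nat_one_div_lt (show 0 < ε / 64 by positivity)
  set η : ℝ := 1 / ((n : ℝ) + 1) with hη
  have hη0 : 0 < η := by positivity
  have hb : ∀ p, 0 ≤ B.blockSum g p := fun p => Finset.sum_nonneg fun _ _ => hg _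
  set M : ℝ := ∑ p ∈ (hfin n).toFinset, B.blockSum g p with hM
  have hM0 : 0 ≤ M := Finset.sum_nonneg fun p _ => hb p
  -- This serves only to make `M / card` small, since the numerator here is at least `M`.
  have hlim : Tendsto (fun y => M * ((((initialEnds B.mainSet y).card : ℝ) + 1) /
      (initialPart B.mainSet y).card)) atTop (𝓝 0) := by
    simpa using B.tendsto_ends.const_mul M
  obtain ⟨Y, hY⟩ := eventually_atTop.1
    ((hlim.eventually (gt_mem_nhds (show 0 < ε / 2 by positivity))).and
      (eventually_ge_atTop (B.Q 1)))
  refine ⟨Y, fun y hy => ?_⟩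
  obtain ⟨h1, h2⟩ := hY y hy
  have hc : (0 : ℝ) < (initialPart B.mainSet y).card := by
    exact_mod_cast B.card_initialPart_mainSet_pos h2
  have h3 : ∑ p ∈ B.activeBlocks y, B.blockSum g p ≤
      M + η * (∑ p ∈ B.activeBlocks y, 2 ^ p.2 * B.L p.1 : ℕ) := by
    rw [← Finset.sum_filter_add_sum_filter_not (B.activeBlocks y)
      (fun p => p ∈ (hfin n).toFinset)]
    refine add_le_add ?_ ?_
    · exact Finset.sum_le_sum_of_subset_of_nonneg (fun p hp => (Finset.mem_filter.1 hp).2)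
        fun p _ _ => hb p
    · rw [Nat.cast_sum, Finset.mul_sum]
      refine le_trans (Finset.sum_le_sum fun p hp => ?_)
        (Finset.sum_le_sum_of_subset_of_nonneg (Finset.filter_subset _ _) fun p _ _ => by
          positivity)
      obtain ⟨hp1, hp2⟩ := Finset.mem_filter.1 hp
      rw [Set.Finite.mem_toFinset] at hp2
      by_contra hcon
      exact hp2 ⟨(B.mem_activeBlocks.1 hp1).1, not_le.1 hcon⟩
  have h4 : ((∑ p ∈ B.activeBlocks y, 2 ^ p.2 * B.L p.1 : ℕ) : ℝ) ≤
      32 * (initialPart B.mainSet y).card := by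
    exact_mod_cast B.sum_activeBlocks_le_card h2
  have h5 := B.sum_initialPart_extraSet_le y hg
  have h0 : 0 ≤ ∑ m ∈ initialPart B.extraSet y, g m := Finset.sum_nonneg fun m _ => hg m
  rw [dist_zero_right, Real.norm_of_nonneg (by positivity), div_lt_iff₀ hc]
  rw [← mul_div_assoc, div_lt_iff₀ hc] at h1
  have h6 : M ≤ M * (((initialEnds B.mainSet y).card : ℝ) + 1) :=
    le_mul_of_one_le_right hM0 (by linarith [(initialEnds B.mainSet y).card.cast_nonneg (α := ℝ)])
  have h7 : η * (∑ p ∈ B.activeBlocks y, 2 ^ p.2 * B.L p.1 : ℕ) ≤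
      ε / 64 * (32 * (initialPart B.mainSet y).card) := by gcongr
  change _ ≤ ∑ p ∈ B.activeBlocks y, B.blockSum g p at h5
  linarith

theorem tendsto_card_extra (hd : ∀ s, s + 1 ≤ B.d s) :
    Tendsto (fun y => ((initialPart B.extraSet y).card : ℝ) / (initialPart B.mainSet y).card)
      atTop (𝓝 0) := by
  have := B.tendsto_extra (g := fun _ => 1) (fun _ => zero_le_one) (fun n => by
    refine Set.Finite.subset ((Finset.range (n + 1)).sigma (fun s => Finset.range (B.K s)) |>.image
      (fun p => ((p.1, p.2) : ℕ × ℕ))).finite_toSet ?_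
    rintro ⟨s, j⟩ ⟨h1, h2⟩
    refine Finset.mem_coe.2 (Finset.mem_image.2 ⟨⟨s, j⟩, ?_, rfl⟩)
    simp only [Finset.mem_sigma, Finset.mem_range]
    refine ⟨?_, h1⟩
    simp only [blockSum, Finset.sum_const, Finset.card_range, nsmul_eq_mul, mul_one, B.L_eq,
      Nat.cast_mul] at h2
    rw [one_div, inv_mul_lt_iff₀ (by positivity)] at h2
    have hd' := hd s
    have h3 : 2 ^ j * (B.d s * B.w s) < (n + 1) * (2 ^ j * B.w s) := by exact_mod_cast h2
    have h4 : B.d s * (2 ^ j * B.w s) < (n + 1) * (2 ^ j * B.w s) := by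
      calc _ = 2 ^ j * (B.d s * B.w s) := by ring
        _ < _ := h3
    have := lt_of_mul_lt_mul_right h4 (Nat.zero_le _)
    omega)
  simpa using this

theorem tendsto_initialAverage_fullSet {X : Type u} {T : X → X} {f : X → ℝ} {x : X} {l : ℝ}
    (hmain : Tendsto (fun y => initialAverage B.mainSet T f y x) atTop (𝓝 l))
    (hextra : Tendsto (fun y => (∑ m ∈ initialPart B.extraSet y, |f (T^[m] x)|) /
      (initialPart B.mainSet y).card) atTop (𝓝 0))
    (hcard : Tendsto (fun y => ((initialPart B.extraSet y).card : ℝ) /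
      (initialPart B.mainSet y).card) atTop (𝓝 0)) :
    Tendsto (fun y => initialAverage B.fullSet T f y x) atTop (𝓝 l) := by
  classical
  set R : ℕ → Finset ℕ := fun y => initialPart B.extraSet y \ initialPart B.mainSet y with hR
  have hR1 : Tendsto (fun y => (∑ m ∈ R y, f (T^[m] x)) / (initialPart B.mainSet y).card)
      atTop (𝓝 0) := by
    refine squeeze_zero_norm (fun y => ?_) hextra
    rw [norm_div, Real.norm_natCast, Real.norm_eq_abs]
    gcongr
    exact (Finset.abs_sum_le_sum_abs _ _).trans (Finset.sum_le_sum_of_subset_of_nonneg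
      Finset.sdiff_subset fun _ _ _ => abs_nonneg _)
  have hR2 : Tendsto (fun y => ((R y).card : ℝ) / (initialPart B.mainSet y).card)
      atTop (𝓝 0) := by
    refine squeeze_zero (fun y => by positivity) (fun y => ?_) hcard
    gcongr
    exact Finset.sdiff_subset
  have h := (hmain.add hR1).div (hR2.const_add 1) (by norm_num)
  rw [add_zero, add_zero, div_one] at h
  refine h.congr' ?_
  filter_upwards [eventually_ge_atTop (B.Q 1)] with y hy
  have hc : (0 : ℝ) < (initialPart B.mainSet y).card := by
    exact_mod_cast B.card_initialPart_mainSet_pos hy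
  have hdisj : Disjoint (initialPart B.mainSet y) (R y) := Finset.disjoint_sdiff
  have hfull : initialPart B.fullSet y = initialPart B.mainSet y ∪ R y := by
    ext m
    simp only [hR, Finset.mem_union, Finset.mem_sdiff, mem_initialPart, fullSet, Set.mem_union]
    tauto
  simp only [Pi.div_apply]
  rw [initialAverage, initialAverage, hfull, Finset.sum_union hdisj,
    Finset.card_union_of_disjoint hdisj]
  push_cast
  field_simp

section
variable {X : Type u} [MeasurableSpace X] {μ : Measure X} {T : X → X} {φ : ℝ → ℝ}

/-- A block sum this large remains large after discarding the values of `|f|` up to `t = ε d / 2`.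
On the remaining set `φ |f| ≥ φ √d`, and Markov's inequality applies. -/
theorem measure_blockSum_le (hT : MeasurePreserving T μ μ) (hφ : IsGauge φ) {f : X → ℝ}
    (hf : Measurable f) {ε : ℝ} (hε : 0 < ε) {s j : ℕ} (hs : √(B.d s) ≤ ε * B.d s / 2) :
    ENNReal.ofReal (ε / 2 * (B.d s * φ √(B.d s))) *
      μ {x | ε * (2 ^ j * B.L s : ℕ) < B.blockSum (fun m => |f (T^[m] x)|) (s, j)} ≤
      ∫⁻ x, ENNReal.ofReal (|f x| * φ |f x|) ∂μ := by
  set t : ℝ := ε * B.d s / 2 with ht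
  have hdp : (0 : ℝ) < B.d s := by exact_mod_cast B.d_pos s
  have hwp : (0 : ℝ) < B.w s := by exact_mod_cast B.w_pos s
  have ht0 : 0 < t := by positivity
  have hφ0 : 0 < φ √(B.d s) := zero_lt_one.trans_le (hφ.one_le _)
  set h : X → ENNReal := {x | t < |f x|}.indicator (fun x => ENNReal.ofReal |f x|) with hh
  have hset : MeasurableSet {x | t < |f x|} :=
    measurableSet_lt measurable_const (continuous_abs.measurable.comp hf)
  have hm : Measurable h := (continuous_abs.measurable.comp hf).ennreal_ofReal.indicator hset
  have hmT : ∀ m, Measurable fun x => h (T^[m] x) := fun m => hm.comp (hT.iterate m).measurable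
  have hint : ENNReal.ofReal (φ √(B.d s)) * ∫⁻ x, h x ∂μ ≤
      ∫⁻ x, ENNReal.ofReal (|f x| * φ |f x|) ∂μ := by
    rw [← lintegral_const_mul _ hm]
    refine lintegral_mono fun x => ?_
    by_cases hx : x ∈ {x | t < |f x|}
    · simp only [hh, Set.indicator_of_mem hx]
      rw [← ENNReal.ofReal_mul hφ0.le, mul_comm]
      refine ENNReal.ofReal_le_ofReal (mul_le_mul_of_nonneg_left (hφ.monotone ?_) (abs_nonneg _))
      exact hs.trans (le_of_lt hx)
    · simp [hh, Set.indicator_of_notMem hx]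
  set P := 2 ^ j * B.w s with hP
  set Z := {x | ENNReal.ofReal (P * t) ≤ ∑ l ∈ Finset.range P, h (T^[B.start s j + l] x)}
    with hZ
  have hsub : {x | ε * (2 ^ j * B.L s : ℕ) < B.blockSum (fun m => |f (T^[m] x)|) (s, j)} ⊆ Z := by
    intro x hx
    simp only [hZ, Set.mem_ofPred_eq, blockSum] at hx ⊢
    have h1 : ∀ y, ENNReal.ofReal |f y| ≤ ENNReal.ofReal t + h y := by
      intro y
      by_cases hy : y ∈ {x | t < |f x|}
      · simp [hh, Set.indicator_of_mem hy]
      · simp only [hh, Set.indicator_of_notMem hy, add_zero]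
        exact ENNReal.ofReal_le_ofReal (not_lt.1 hy)
    have h2 : ENNReal.ofReal (∑ l ∈ Finset.range P, |f (T^[B.start s j + l] x)|) ≤
        ENNReal.ofReal (P * t) + ∑ l ∈ Finset.range P, h (T^[B.start s j + l] x) := by
      rw [ENNReal.ofReal_sum_of_nonneg fun _ _ => abs_nonneg _]
      refine (Finset.sum_le_sum fun l _ => h1 _).trans (le_of_eq ?_)
      rw [Finset.sum_add_distrib, Finset.sum_const, Finset.card_range, nsmul_eq_mul,
        ENNReal.ofReal_mul (by positivity), ENNReal.ofReal_natCast]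
    -- Because `L = d * w`, the threshold `ε * 2 ^ j * L` equals `2 * P * t`; the truncated part
    -- accounts for at most one half of it.
    have h3 : ENNReal.ofReal (P * t) + ENNReal.ofReal (P * t) ≤
        ENNReal.ofReal (P * t) + ∑ l ∈ Finset.range P, h (T^[B.start s j + l] x) := by
      rw [← ENNReal.ofReal_add (by positivity) (by positivity)]
      refine le_trans (ENNReal.ofReal_le_ofReal (le_of_eq_of_le ?_ hx.le)) h2
      rw [B.L_eq, hP, ht]
      push_cast
      ring
    exact (ENNReal.add_le_add_iff_left ENNReal.ofReal_ne_top).1 h3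
  have hmarkov : ENNReal.ofReal (P * t) * μ Z ≤
      ∫⁻ x, ∑ l ∈ Finset.range P, h (T^[B.start s j + l] x) ∂μ := mul_meas_ge_le_lintegral₀ (μ := μ)
    (Finset.measurable_fun_sum (Finset.range P)
      fun l _ => hmT (B.start s j + l)).aemeasurable (ENNReal.ofReal (P * t))
  rw [lintegral_finsetSum _ fun l _ => hmT _] at hmarkov
  have h4 : ∀ m, ∫⁻ x, h (T^[m] x) ∂μ = ∫⁻ x, h x ∂μ := fun m =>
    (hT.iterate m).lintegral_comp hm
  simp only [h4, Finset.sum_const, Finset.card_range, nsmul_eq_mul] at hmarkov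
  have hP0 : (P : ENNReal) ≠ 0 := by
    have := B.w_pos s
    simp [hP]; omega
  rw [ENNReal.ofReal_mul (by positivity), ENNReal.ofReal_natCast, mul_assoc,
    ENNReal.mul_le_mul_iff_right hP0 (by simp)] at hmarkov
  calc _ ≤ ENNReal.ofReal (φ √(B.d s)) * (ENNReal.ofReal t * μ Z) := by
        rw [← mul_assoc (ENNReal.ofReal (φ √(B.d s))), ← ENNReal.ofReal_mul hφ0.le]
        refine mul_le_mul' (le_of_eq ?_) (measure_mono hsub)
        congr 1; rw [ht]; ring
    _ ≤ ENNReal.ofReal (φ √(B.d s)) * ∫⁻ x, h x ∂μ := by gcongr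
    _ ≤ _ := hint

theorem ae_finite_blockSum [IsFiniteMeasure μ] (hT : MeasurePreserving T μ μ) (hφ : IsGauge φ)
    (hd : ∀ s, s + 1 ≤ B.d s)
    (hK : ∀ s, (B.K s : ℝ) * 2 ^ s ≤ B.d s * φ √(B.d s)) {f : X → ℝ} (hf : Measurable f)
    (hfφ : ∫⁻ x, ENNReal.ofReal (|f x| * φ |f x|) ∂μ ≠ ⊤) {ε : ℝ} (hε : 0 < ε) :
    ∀ᵐ x ∂μ, {p : ℕ × ℕ | p.2 < B.K p.1 ∧ ε * (2 ^ p.2 * B.L p.1 : ℕ) <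
      B.blockSum (fun m => |f (T^[m] x)|) p}.Finite := by
  set I := ∫⁻ x, ENNReal.ofReal (|f x| * φ |f x|) ∂μ
  -- From stage `s₀` on, `√d ≥ 2 / ε`, which is the condition `√d ≤ ε d / 2`. Earlier stages have
  -- only finitely many intervals.
  obtain ⟨s₀, hs₀⟩ := exists_nat_gt ((2 / ε) ^ 2)
  set A : ℕ × ℕ → Set X := fun p => {x | (p.2 < B.K p.1 ∧ s₀ ≤ p.1) ∧
    ε * (2 ^ p.2 * B.L p.1 : ℕ) < B.blockSum (fun m => |f (T^[m] x)|) p} with hA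
  set c : ENNReal := I / ENNReal.ofReal (ε / 2) with hc
  have hε2 : ENNReal.ofReal (ε / 2) ≠ 0 := by simpa using hε
  have hct : c ≠ ⊤ := ENNReal.div_ne_top hfφ hε2
  have hbound : ∀ s j, μ (A (s, j)) ≤
      (Finset.range (B.K s) : Set ℕ).indicator
        (fun _ => c * ((B.K s : ENNReal)⁻¹ * (2 ^ s : ENNReal)⁻¹)) j := by
    intro s j
    by_cases hj : j < B.K s
    · by_cases hs : s₀ ≤ s
      · have hsd : √(B.d s) ≤ ε * B.d s / 2 := by
          have h1 : ((s : ℝ) + 1) ≤ B.d s := by exact_mod_cast hd s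
          have h2 : (s₀ : ℝ) ≤ s := by exact_mod_cast hs
          have h3 : 2 / ε ≤ √(B.d s) := Real.le_sqrt_of_sq_le (by linarith)
          rw [div_le_iff₀ hε] at h3
          have h4 : √(B.d s : ℝ) * √(B.d s : ℝ) = B.d s := Real.mul_self_sqrt (by positivity)
          nlinarith [Real.sqrt_nonneg (B.d s : ℝ)]
        have h1 := B.measure_blockSum_le (j := j) hT hφ hf hε hsd
        have hKpos : (B.K s : ENNReal) ≠ 0 := by have := B.two_le_K s; simp; omega
        rw [Set.indicator_of_mem (by simpa using hj), ← ENNReal.mul_inv (Or.inl hKpos)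
          (Or.inl (by simp)), hc, div_eq_mul_inv, mul_assoc, ← ENNReal.mul_inv (Or.inl hε2)
          (Or.inl (by simp)), ← div_eq_mul_inv,
          ENNReal.le_div_iff_mul_le (Or.inl (by simp [hKpos, hε]))
          (Or.inl (ENNReal.mul_ne_top (by simp) (ENNReal.mul_ne_top (by simp) (by simp)))),
          mul_comm]
        refine le_trans (mul_le_mul' ?_ (measure_mono fun x hx => hx.2)) h1
        rw [ENNReal.ofReal_mul (by positivity)]
        refine mul_le_mul' le_rfl (le_of_eq_of_le ?_ (ENNReal.ofReal_le_ofReal (hK s)))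
        rw [ENNReal.ofReal_mul (by positivity), ENNReal.ofReal_natCast,
          ENNReal.ofReal_pow (by norm_num)]
        simp
      · have : A (s, j) = ∅ := by
          ext x; simp [hA, hs]
        simp [this]
    · have : A (s, j) = ∅ := by
        ext x; simp [hA, hj]
      simp [this]
  have hsum : ∑' p, μ (A p) ≠ ⊤ := by
    rw [ENNReal.tsum_prod (f := fun s j => μ (A (s, j)))]
    refine ne_top_of_le_ne_top (b := c * 2) (ENNReal.mul_ne_top hct (by simp)) ?_
    rw [← ENNReal.tsum_geometric_two, ← ENNReal.tsum_mul_left]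
    refine ENNReal.tsum_le_tsum fun s => ?_
    refine (ENNReal.tsum_le_tsum (hbound s)).trans ?_
    have hKpos : (B.K s : ENNReal) ≠ 0 := by have := B.two_le_K s; simp; omega
    rw [tsum_eq_sum (s := Finset.range (B.K s)) fun j hj => Set.indicator_of_notMem (by simpa using hj) _,
      Finset.sum_congr rfl fun j hj => Set.indicator_of_mem (Finset.mem_coe.2 hj) _,
      Finset.sum_const, Finset.card_range, nsmul_eq_mul, mul_left_comm, ← mul_assoc (B.K s : ENNReal),
      ENNReal.mul_inv_cancel hKpos (by simp), one_mul, ENNReal.inv_pow]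
  have hfin := ae_finite_setOfPred_mem hsum
  filter_upwards [hfin] with x hx
  refine (hx.union ((Finset.range s₀).sigma (fun s => Finset.range (B.K s)) |>.image
      (fun p => ((p.1, p.2) : ℕ × ℕ))).finite_toSet).subset ?_
  rintro ⟨s, j⟩ ⟨h1, h2⟩
  by_cases hs : s₀ ≤ s
  · exact Or.inl ⟨⟨h1, hs⟩, h2⟩
  · refine Or.inr (Finset.mem_coe.2 (Finset.mem_image.2 ⟨⟨s, j⟩, ?_, rfl⟩))
    simp only [Finset.mem_sigma, Finset.mem_range]
    exact ⟨by omega, h1⟩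

end

theorem universallyGood {φ : ℝ → ℝ} (hφ : IsGauge φ) (hd : ∀ s, s + 1 ≤ B.d s)
    (hK : ∀ s, (B.K s : ℝ) * 2 ^ s ≤ B.d s * φ √(B.d s)) :
    UniversallyGood.{u} (orliczSpace.{u} φ) (enumeration B.fullSet) := by
  intro X _ _ μ T hsys f hf
  have := hsys.isProbabilityMeasure
  have hT := hsys.measurePreserving
  obtain ⟨hfm, hfφ⟩ := hf
  obtain ⟨g, hg, hfg⟩ := hfm
  have hgφ : ∫⁻ x, ENNReal.ofReal (|g x| * φ |g x|) ∂μ ≠ ⊤ := by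
    have : ∫⁻ x, ENNReal.ofReal (|f x| * φ |f x|) ∂μ = ∫⁻ x, ENNReal.ofReal (|g x| * φ |g x|) ∂μ :=
      lintegral_congr_ae (hfg.mono fun x hx => by simp only [hx])
    exact this ▸ hfφ.ne
  have hgi : Integrable g μ := by
    refine ⟨hg.aestronglyMeasurable, lt_of_le_of_lt (lintegral_mono fun x => ?_) hgφ.lt_top⟩
    rw [Real.enorm_eq_ofReal_abs]
    exact ENNReal.ofReal_le_ofReal (le_mul_of_one_le_right (abs_nonneg _) (hφ.one_le _))
  have h1 := ae_exists_tendsto_initialAverage hT B.family_isChain B.family_nonempty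
    B.family_difference (by norm_num) B.mainSet_dominated B.tendsto_ends hg hgi
  have h2 : ∀ᵐ x ∂μ, ∀ n : ℕ, {p : ℕ × ℕ | p.2 < B.K p.1 ∧
      1 / ((n : ℝ) + 1) * (2 ^ p.2 * B.L p.1 : ℕ) <
        B.blockSum (fun m => |g (T^[m] x)|) p}.Finite :=
    ae_all_iff.2 fun n => B.ae_finite_blockSum hT hφ hd hK hg hgφ (by positivity)
  have h3 : ∀ᵐ x ∂μ, ∀ m, f (T^[m] x) = g (T^[m] x) :=
    ae_all_iff.2 fun m => (hT.iterate m).quasiMeasurePreserving.ae hfg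
  filter_upwards [h1, h2, h3] with x ⟨l, hl⟩ hx2 hx3
  refine ⟨l, ?_⟩
  have h4 := B.tendsto_initialAverage_fullSet hl
    (B.tendsto_extra (fun _ => abs_nonneg _) hx2) (B.tendsto_card_extra hd)
  refine (h4.comp (enumeration_strictMono B.infinite_fullSet).tendsto_atTop).congr fun N => ?_
  rw [Function.comp_apply, ← ergodicAverage_enumeration_eq B.infinite_fullSet]
  simp only [ergodicAverage, hx3]

end BlockScheme

/-! ### Height functions in aperiodic systems -/

theorem height_iterate {X : Type u} {T : X → X} {r : X → ℕ} (hr : ∀ x i, r x = i + 1 → r (T x) = i) (m : ℕ) (x : X)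
    (h : m ≤ r x) : r (T^[m] x) = r x - m := by
  induction m with
  | zero => simp
  | succ m ih =>
    rw [Function.iterate_succ_apply']
    refine hr _ _ ?_
    rw [ih (by omega)]; omega

section
variable {X : Type u} [MeasurableSpace X] {μ : Measure X} {T : X → X}

/-- In an aperiodic system there is a measurable labelling of the points by natural numbers that
takes different values at any two close points of almost every orbit. -/
theorem IsAperiodicSystem.exists_label [MeasurableSpace.CountablySeparated X]
    (hsys : IsAperiodicSystem μ T) (H : ℕ) :
    ∃ c : X → ℕ, Measurable c ∧ ∀ᵐ x ∂μ, ∀ n, 1 ≤ n → n ≤ H → c (T^[n] x) ≠ c x := by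
  classical
  have hT := hsys.measurePreserving
  obtain ⟨π, hπ, hinj⟩ := MeasurableSpace.measurable_injection_nat_bool_of_countablySeparated X
  set p : ℕ → X → ℕ := fun N x => Encodable.encode fun i : Fin N => π x i with hp
  have hpm : ∀ N, Measurable (p N) := fun N =>
    (Measurable.of_discrete (f := fun a : Fin N → Bool => Encodable.encode a)).comp
      (measurable_pi_lambda _ fun i => (measurable_pi_apply (i : ℕ)).comp hπ)
  -- The index `k` codes a prefix length and a prefix. A point lies in `C k` if it has that prefix
  -- and its next `H` iterates do not; the label is the least such `k`. The second alternative below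
  -- makes the label total, and aperiodicity makes it irrelevant almost everywhere.
  set C : ℕ → Set X := fun k => {x | p k.unpair.1 x = k.unpair.2 ∧
    ∀ n ∈ Finset.Icc 1 H, p k.unpair.1 (T^[n] x) ≠ k.unpair.2} with hC
  have hCm : ∀ k, MeasurableSet (C k) := by
    intro k
    have : C k = {x | p k.unpair.1 x = k.unpair.2} ∩
        ⋂ n ∈ Finset.Icc 1 H, {x | p k.unpair.1 (T^[n] x) = k.unpair.2}ᶜ := by
      ext x; simp [hC]
    rw [this]
    refine (hpm _ (measurableSet_singleton _)).inter (Finset.measurableSet_biInter _ fun n _ => ?_)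
    exact (((hpm _).comp (hT.iterate n).measurable) (measurableSet_singleton _)).compl
  have hex : ∀ x, ∃ k, x ∈ C k ∨ x ∉ ⋃ k, C k := by
    intro x
    by_cases h : x ∈ ⋃ k, C k
    · obtain ⟨k, hk⟩ := Set.mem_iUnion.1 h
      exact ⟨k, Or.inl hk⟩
    · exact ⟨0, Or.inr h⟩
  refine ⟨fun x => Nat.find (hex x), measurable_find _ fun k =>
    (hCm k).union (MeasurableSet.iUnion hCm).compl, ?_⟩
  have haper : ∀ᵐ x ∂μ, ∀ n, 1 ≤ n → T^[n] x ≠ x :=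
    ae_all_iff.2 fun n => by
      by_cases hn : 1 ≤ n
      · exact (hsys.aperiodic n hn).mono fun x hx _ => hx
      · exact ae_of_all _ fun x h => absurd h hn
  have hcov : ∀ x, (∀ n, 1 ≤ n → T^[n] x ≠ x) → x ∈ ⋃ k, C k := by
    intro x hx
    have h1 : ∀ n, 1 ≤ n → ∃ i, π (T^[n] x) i ≠ π x i := fun n hn => by
      by_contra hcon
      push Not at hcon
      exact hx n hn (hinj (funext hcon))
    choose! i hi using h1
    set N := (Finset.Icc 1 H).sup i + 1 with hN
    refine Set.mem_iUnion.2 ⟨Nat.pair N (p N x), ?_⟩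
    simp only [hC, Set.mem_ofPred_eq, Nat.unpair_pair, true_and]
    intro n hn heq
    have h2 := Encodable.encode_injective heq
    have h3 : i n < N := Nat.lt_succ_of_le (Finset.le_sup (f := i) hn)
    exact hi n (Finset.mem_Icc.1 hn).1 (congr_fun h2 ⟨i n, h3⟩)
  have hall : ∀ᵐ x ∂μ, ∀ m, x ∈ ⋃ k, C k ∧ T^[m] x ∈ ⋃ k, C k := by
    have h1 : ∀ᵐ x ∂μ, x ∈ ⋃ k, C k := haper.mono hcov
    exact ae_all_iff.2 fun m => h1.and ((hT.iterate m).quasiMeasurePreserving.ae h1)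
  filter_upwards [hall] with x hx n hn hnH heq
  have h1 := (Nat.find_spec (hex x)).resolve_right (not_not.2 (hx 0).1)
  have h2 := (Nat.find_spec (hex (T^[n] x))).resolve_right (not_not.2 (hx n).2)
  rw [heq] at h2
  exact h1.2 n (Finset.mem_Icc.2 ⟨hn, hnH⟩) h2.1

/-- In an aperiodic system there are sets with long return times that almost every orbit enters. -/
theorem IsAperiodicSystem.exists_sweeping_set [MeasurableSpace.CountablySeparated X]
    (hsys : IsAperiodicSystem μ T) (H : ℕ) :
    ∃ A : Set X, MeasurableSet A ∧ (∀ x ∈ A, ∀ n, 1 ≤ n → n ≤ H → T^[n] x ∉ A) ∧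
      ∀ᵐ x ∂μ, ∃ n, T^[n] x ∈ A := by
  classical
  have hT := hsys.measurePreserving
  have := hsys.isProbabilityMeasure
  obtain ⟨c, hc, hcne⟩ := hsys.exists_label H
  have hcT : ∀ n, Measurable fun x => c (T^[n] x) := fun n => hc.comp (hT.iterate n).measurable
  -- Points whose label has a strict minimum at time `H` of the window `[0, 2 H]`. The window is
  -- centred at `H`, not at `0`, because `T` need not be invertible. Two strict minima cannot be
  -- within distance `H`.
  set A : Set X := {x | ∀ n ∈ (Finset.range (2 * H + 1)).erase H, c (T^[H] x) < c (T^[n] x)}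
    with hA
  refine ⟨A, ?_, ?_, ?_⟩
  · have : A = ⋂ n ∈ (Finset.range (2 * H + 1)).erase H, {x | c (T^[H] x) < c (T^[n] x)} := by
      ext x; simp [hA]
    rw [this]
    exact Finset.measurableSet_biInter _ fun n _ => measurableSet_lt (hcT H) (hcT n)
  · intro x hx n hn hnH hxn
    have h1 := hx (H + n) (by simp; omega)
    have h2 := hxn (H - n) (by simp; omega)
    rw [← Function.iterate_add_apply, ← Function.iterate_add_apply, Nat.sub_add_cancel hnH] at h2
    omega
  · have h1 : ∀ᵐ x ∂μ, ∀ m n, 1 ≤ n → n ≤ H → c (T^[n] (T^[m] x)) ≠ c (T^[m] x) :=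
      ae_all_iff.2 fun m => (hT.iterate m).quasiMeasurePreserving.ae hcne
    -- By Poincaré recurrence some label recurs infinitely often along the orbit. The least such
    -- label is eventually a lower bound, so each of its late occurrences is a strict local minimum.
    have h2 : ∀ᵐ x ∂μ, ∀ v, c x = v → ∃ᶠ n in atTop, c (T^[n] x) = v :=
      ae_all_iff.2 fun v => hT.conservative.ae_mem_imp_frequently_image_mem
        (hc (measurableSet_singleton v)).nullMeasurableSet
    filter_upwards [h1, h2] with x hx1 hx2
    have hex : ∃ v, ∃ᶠ n in atTop, c (T^[n] x) = v := ⟨_, hx2 _ rfl⟩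
    set v := Nat.find hex
    have hv : ∃ᶠ n in atTop, c (T^[n] x) = v := Nat.find_spec hex
    have hlow : ∀ᶠ n in atTop, v ≤ c (T^[n] x) := by
      have h3 : ∀ᶠ n in atTop, ∀ k ∈ Finset.range v, c (T^[n] x) ≠ k :=
        (Finset.eventually_all _).2 fun k hk =>
          not_frequently.1 (Nat.find_min hex (Finset.mem_range.1 hk))
      exact h3.mono fun n hn => by
        by_contra hcon
        exact hn _ (Finset.mem_range.2 (not_le.1 hcon)) rfl
    obtain ⟨N, hN⟩ := eventually_atTop.1 hlow
    obtain ⟨n, hn, hnv⟩ := frequently_atTop.1 hv (N + H)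
    refine ⟨n - H, fun k hk => ?_⟩
    simp only [Finset.mem_erase, Finset.mem_range] at hk
    rw [← Function.iterate_add_apply, ← Function.iterate_add_apply,
      show H + (n - H) = n by omega, hnv]
    refine lt_of_le_of_ne (hN _ (by omega)) fun heq => ?_
    rcases lt_or_gt_of_ne hk.1 with hlt | hlt
    · have h4 := hx1 (k + (n - H)) (H - k) (by omega) (by omega)
      rw [← Function.iterate_add_apply, show H - k + (k + (n - H)) = n by omega, hnv] at h4
      exact h4 heq
    · have h4 := hx1 n (k - H) (by omega) (by omega)
      rw [← Function.iterate_add_apply, show k - H + n = k + (n - H) by omega, hnv] at h4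
      exact h4 heq.symm

/-- In an aperiodic system there is a measurable height function which decreases by one along the
orbits until it reaches `0`, which happens on a small set only. -/
theorem IsAperiodicSystem.exists_height [MeasurableSpace.CountablySeparated X]
    (hsys : IsAperiodicSystem μ T) (H : ℕ) :
    ∃ r : X → ℕ, Measurable r ∧ (∀ x i, r x = i + 1 → r (T x) = i) ∧
      (H : ENNReal) * μ {x | r x = 0} ≤ 1 := by
  classical
  have hT := hsys.measurePreserving
  have := hsys.isProbabilityMeasure
  obtain ⟨A, hA, hdisj, hsweep⟩ := hsys.exists_sweeping_set H
  have hAT : ∀ n, MeasurableSet (T^[n] ⁻¹' A) := fun n => (hT.iterate n).measurable hA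
  -- The height is the hitting time of `A`, with value `0` on the null set of points that never
  -- enter `A`.
  have hex : ∀ x, ∃ n, T^[n] x ∈ A ∨ ∀ m, T^[m] x ∉ A := by
    intro x
    by_cases h : ∃ n, T^[n] x ∈ A
    · obtain ⟨n, hn⟩ := h
      exact ⟨n, Or.inl hn⟩
    · push Not at h
      exact ⟨0, Or.inr h⟩
  have hmeas : ∀ k, MeasurableSet {x | T^[k] x ∈ A ∨ ∀ m, T^[m] x ∉ A} := fun k => by
    have : {x | T^[k] x ∈ A ∨ ∀ m, T^[m] x ∉ A} =
        T^[k] ⁻¹' A ∪ ⋂ m, (T^[m] ⁻¹' A)ᶜ := by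
      ext x; simp
    rw [this]
    exact (hAT k).union (MeasurableSet.iInter fun m => (hAT m).compl)
  refine ⟨fun x => Nat.find (hex x), measurable_find _ hmeas, ?_, ?_⟩
  · intro x i hi
    obtain ⟨h1, h2⟩ := (Nat.find_eq_iff (hex x)).1 hi
    have h0 : ∃ m, T^[m] x ∈ A := by
      have := h2 0 (by omega)
      push Not at this
      exact this.2
    have h1' := h1.resolve_right (by push Not; exact h0)
    refine (Nat.find_eq_iff (hex (T x))).2 ⟨Or.inl h1', fun n hn => ?_⟩
    have h3 := h2 (n + 1) (by omega)
    push Not at h3 ⊢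
    exact ⟨h3.1, i, h1'⟩
  · have hle : μ {x | Nat.find (hex x) = 0} ≤ μ A := by
      refine measure_mono_ae ?_
      filter_upwards [hsweep] with x hx h0
      have h1 := (Nat.find_eq_zero (hex x)).1 h0
      exact h1.resolve_right (by push Not; exact hx)
    have hpd : Set.PairwiseDisjoint (Finset.range H : Set ℕ) fun n => T^[n] ⁻¹' A := by
      have key : ∀ m n, m < n → n < H → Disjoint (T^[m] ⁻¹' A) (T^[n] ⁻¹' A) := by
        intro m n hmn hn
        rw [Set.disjoint_left]
        intro x hx1 hx2
        refine hdisj _ hx1 (n - m) (by omega) (by omega) ?_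
        rw [← Function.iterate_add_apply, Nat.sub_add_cancel hmn.le]
        exact hx2
      intro m hm n hn hmn
      simp only [Finset.coe_range, Set.mem_Iio] at hm hn
      rcases lt_or_gt_of_ne hmn with h | h
      · exact key m n h hn
      · exact (key n m h hm).symm
    calc (H : ENNReal) * μ {x | Nat.find (hex x) = 0} ≤ H * μ A := by gcongr
      _ = ∑ n ∈ Finset.range H, μ (T^[n] ⁻¹' A) := by
          simp [fun n => (hT.iterate n).measure_preimage hA.nullMeasurableSet]
      _ = μ (⋃ n ∈ Finset.range H, T^[n] ⁻¹' A) :=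
          (measure_biUnion_finset hpd fun n _ => hAT n).symm
      _ ≤ 1 := prob_le_one

/-- The level `i` is contained in the preimage of the level `0` under `T^i`. -/
theorem measure_height_lt_le (hT : MeasurePreserving T μ μ) {r : X → ℕ} (hrm : Measurable r)
    (hr : ∀ x i, r x = i + 1 → r (T x) = i) (R : ℕ) :
    μ {x | r x < R} ≤ R * μ {x | r x = 0} := by
  have hlevel : ∀ i, μ {x | r x = i} ≤ μ {x | r x = 0} := by
    intro i
    have h0 : MeasurableSet {x | r x = 0} := hrm (measurableSet_singleton 0)
    rw [← (hT.iterate i).measure_preimage h0.nullMeasurableSet]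
    refine measure_mono fun x hx => ?_
    have hx' : r x = i := hx
    have := height_iterate hr i x hx'.ge
    simp [this, hx']
  have : {x | r x < R} = ⋃ i ∈ Finset.range R, {x | r x = i} := by
    ext x; simp
  rw [this]
  refine (measure_biUnion_finset_le _ _).trans
    ((Finset.sum_le_sum fun i _ => hlevel i).trans (le_of_eq ?_))
  simp

/-- Moving down the tower shows that the masses of the residue classes are nonincreasing in the
residue. Wrapping around from `0` to `V - 1` costs only `μ {r = 0} ≤ 1 / V`. So each of the `V`
classes has mass at most `2 / V`. -/
theorem measure_height_mod_lt_le [IsProbabilityMeasure μ] (hT : MeasurePreserving T μ μ)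
    {r : X → ℕ} (hrm : Measurable r) (hr : ∀ x i, r x = i + 1 → r (T x) = i) {V : ℕ}
    (hV : (V : ENNReal) * μ {x | r x = 0} ≤ 1) (W : ℕ) :
    (V : ENNReal) * μ {x | r x % V < W} ≤ 2 * W := by
  rcases Nat.eq_zero_or_pos V with rfl | hV0
  · simp
  set ρ : ℕ → ENNReal := fun a => μ {x | r x % V = a} with hρ
  have hmeas : ∀ a, MeasurableSet {x | r x % V = a} := fun a =>
    ((Measurable.of_discrete (f := fun n : ℕ => n % V)).comp hrm) (measurableSet_singleton a)
  have hshift : ∀ a m, m ≤ a → a < V → ρ a ≤ ρ (a - m) := by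
    intro a m hma ha
    rw [hρ]
    simp only
    rw [← (hT.iterate m).measure_preimage (hmeas (a - m)).nullMeasurableSet]
    refine measure_mono fun x hx => ?_
    simp only [Set.mem_ofPred_eq, Set.mem_preimage] at hx ⊢
    have h1 := Nat.div_add_mod (r x) V
    rw [height_iterate hr m x (by omega),
      show r x - m = a - m + V * (r x / V) by omega, Nat.add_mul_mod_self_left,
      Nat.mod_eq_of_lt (by omega)]
  have hwrap : ρ 0 ≤ μ {x | r x = 0} + ρ (V - 1) := by
    have h1 : {x | r x % V = 0} ⊆ {x | r x = 0} ∪ T ⁻¹' {x | r x % V = V - 1} := by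
      intro x hx
      simp only [Set.mem_ofPred_eq, Set.mem_union, Set.mem_preimage] at hx ⊢
      by_cases h0 : r x = 0
      · exact Or.inl h0
      · right
        have h1 := Nat.div_add_mod (r x) V
        have h2 := height_iterate hr 1 x (by omega)
        rw [Function.iterate_one] at h2
        obtain ⟨q, hq⟩ : ∃ q, r x / V = q + 1 := by
          refine ⟨r x / V - 1, ?_⟩
          have : r x / V ≠ 0 := fun h => by rw [h] at h1; omega
          exact (Nat.sub_add_cancel (Nat.pos_of_ne_zero this)).symm
        rw [hq, mul_add, mul_one] at h1
        rw [h2, show r x - 1 = V - 1 + V * q by omega, Nat.add_mul_mod_self_left,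
          Nat.mod_eq_of_lt (by omega)]
    refine (measure_mono h1).trans ((measure_union_le _ _).trans ?_)
    rw [hT.measure_preimage (hmeas _).nullMeasurableSet]
  have hcomp : ∀ a c, a < V → c < V → ρ a ≤ μ {x | r x = 0} + ρ c := by
    intro a c ha hc
    have h1 := hshift a a le_rfl ha
    have h2 := hshift (V - 1) (V - 1 - c) (by omega) (by omega)
    rw [Nat.sub_self] at h1
    rw [show V - 1 - (V - 1 - c) = c by omega] at h2
    exact h1.trans (hwrap.trans (by gcongr))
  have hsum : ∑ c ∈ Finset.range V, ρ c ≤ 1 := by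
    rw [hρ, ← measure_biUnion_finset _ fun a _ => hmeas a]
    · exact prob_le_one
    · intro a _ b _ hab
      refine Set.disjoint_left.2 fun x hx hx' => hab ?_
      exact (hx : r x % V = a).symm.trans hx'
  have hone : ∀ a, (V : ENNReal) * ρ a ≤ 2 := by
    intro a
    rcases lt_or_ge a V with ha | ha
    · calc (V : ENNReal) * ρ a = ∑ c ∈ Finset.range V, ρ a := by simp
        _ ≤ ∑ c ∈ Finset.range V, (μ {x | r x = 0} + ρ c) :=
            Finset.sum_le_sum fun c hc => hcomp a c ha (Finset.mem_range.1 hc)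
        _ = V * μ {x | r x = 0} + ∑ c ∈ Finset.range V, ρ c := by
            rw [Finset.sum_add_distrib]; simp
        _ ≤ 1 + 1 := add_le_add hV hsum
        _ = 2 := one_add_one_eq_two
    · have : {x | r x % V = a} = ∅ := by
        ext x
        simp only [Set.mem_ofPred_eq, Set.mem_empty_iff_false, iff_false]
        have := Nat.mod_lt (r x) hV0
        omega
      simp [hρ, this]
  have hcover : {x | r x % V < W} = ⋃ a ∈ Finset.range W, {x | r x % V = a} := by
    ext x; simp
  calc (V : ENNReal) * μ {x | r x % V < W} ≤ V * ∑ a ∈ Finset.range W, ρ a := by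
        rw [hcover]; gcongr; exact measure_biUnion_finset_le _ _
    _ = ∑ a ∈ Finset.range W, V * ρ a := Finset.mul_sum _ _ _
    _ ≤ ∑ a ∈ Finset.range W, 2 := Finset.sum_le_sum fun a _ => hone a
    _ = 2 * W := by simp [mul_comm]

end

/-! ### Sweeping out -/

namespace BlockScheme
variable (B : BlockScheme)

theorem le_initialAverage_fullSet {X : Type u} {T : X → X} {s j : ℕ} (hs : 1 ≤ s) (hj : j < B.K s) {f : X → ℝ}
    (hf : ∀ x, 0 ≤ f x) {h : ℝ} (hh : 0 ≤ h) {x : X}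
    (hx : ∀ l < 2 ^ j * B.w s, h ≤ f (T^[B.start s j + l] x)) :
    h / (5 * B.d s) ≤
      initialAverage B.fullSet T f (B.start s j + 2 ^ j * B.w s) x := by
  set y := B.start s j + 2 ^ j * B.w s with hy
  have hw := B.w_pos s
  have hd := B.d_pos s
  have hcard := B.card_initialPart_fullSet_le hs hj
  have hsub : (Finset.range (2 ^ j * B.w s)).image (fun l => B.start s j + l) ⊆
      initialPart B.fullSet y := by
    intro m hm
    obtain ⟨l, hl, rfl⟩ := Finset.mem_image.1 hm
    rw [Finset.mem_range] at hl
    exact mem_initialPart.2 ⟨by omega, Or.inr ⟨s, j, hj, by omega, by omega⟩⟩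
  have hsum : ((2 ^ j * B.w s : ℕ) : ℝ) * h ≤ ∑ m ∈ initialPart B.fullSet y, f (T^[m] x) := by
    refine le_trans ?_ (Finset.sum_le_sum_of_subset_of_nonneg hsub fun _ _ _ => hf _)
    rw [Finset.sum_image fun a _ b _ h => by simpa using h]
    refine le_trans (le_of_eq ?_) (Finset.sum_le_sum fun l hl => hx l (Finset.mem_range.1 hl))
    simp
  have hpos : (0 : ℝ) < (initialPart B.fullSet y).card := by
    have h1 := Finset.card_le_card hsub
    rw [Finset.card_image_of_injective _ (add_right_injective _), Finset.card_range] at h1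
    have : 0 < 2 ^ j * B.w s := by positivity
    exact_mod_cast this.trans_le h1
  have hcard' : ((initialPart B.fullSet y).card : ℝ) ≤ 5 * (2 ^ j * (B.d s * B.w s)) := by
    rw [B.L_eq] at hcard
    exact_mod_cast hcard
  rw [initialAverage, le_div_iff₀ hpos]
  refine le_trans ?_ hsum
  have hd' : (0 : ℝ) < B.d s := by exact_mod_cast hd
  calc h / (5 * B.d s) * (initialPart B.fullSet y).card
      ≤ h / (5 * B.d s) * (5 * (2 ^ j * (B.d s * B.w s))) := by gcongr
    _ = ((2 ^ j * B.w s : ℕ) : ℝ) * h := by push_cast; field_simp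

section
variable {X : Type u} [MeasurableSpace X] {μ : Measure X} {T : X → X}

/-- A small set containing, for most points, the part of the orbit along one of the additional
intervals of stage `s`. -/
theorem exists_stage_set [MeasurableSpace.CountablySeparated X] (hsys : IsAperiodicSystem μ T)
    (s : ℕ) : ∃ E : Set X, MeasurableSet E ∧ (B.K s : ENNReal) * μ E ≤ 4 ∧
      μ {x | ¬∃ j < B.K s, ∀ l < 2 ^ j * B.w s, T^[B.start s j + l] x ∈ E} ≤ (2 : ENNReal)⁻¹ ^ s := by
  have hT := hsys.measurePreserving
  have := hsys.isProbabilityMeasure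
  set P := 2 ^ B.K s * B.w s with hP
  have hP0 : 0 < P := Nat.mul_pos (by positivity) (B.w_pos s)
  have hK := B.two_le_K s
  set V := B.K s * P with hV
  have hV0 : 0 < V := Nat.mul_pos (by omega) hP0
  have hQ0 := B.four_le_Q s
  set R := 2 * B.Q s ^ 2 with hR
  have hR0 : 0 < R := by positivity
  obtain ⟨q', hq'⟩ : V ∣ B.Q s := by
    refine dvd_trans ⟨2, ?_⟩ (B.dvd_Q s)
    rw [hV, hP]; ring
  -- The tower is high enough both for equidistribution modulo `V` and for the heights below `R` to
  -- have mass at most `2 ^ (-s)`.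
  obtain ⟨r, hrm, hr, hr0⟩ := hsys.exists_height (V * (R * 2 ^ s))
  have hr1 : (V : ENNReal) * μ {x | r x = 0} ≤ 1 := by
    refine le_trans (mul_le_mul' ?_ le_rfl) hr0
    exact_mod_cast Nat.le_mul_of_pos_right _ (by positivity)
  have hr2 : (R : ENNReal) * μ {x | r x = 0} ≤ (2 : ENNReal)⁻¹ ^ s := by
    rw [← ENNReal.inv_pow, ← one_div, ENNReal.le_div_iff_mul_le (Or.inl (by simp)) (Or.inl (by simp))]
    refine le_trans ?_ hr0
    rw [mul_right_comm]
    refine mul_le_mul' ?_ le_rfl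
    exact_mod_cast Nat.le_mul_of_pos_left _ hV0
  refine ⟨{x | r x % V < 2 * P},
    ((Measurable.of_discrete (f := fun n : ℕ => n % V)).comp hrm) measurableSet_Iio, ?_, ?_⟩
  · have h1 := measure_height_mod_lt_le hT hrm hr hr1 (2 * P)
    have hPE : (P : ENNReal) ≠ 0 := by exact_mod_cast hP0.ne'
    refine (ENNReal.mul_le_mul_iff_right hPE (by simp)).1 ?_
    calc (P : ENNReal) * (B.K s * μ {x | r x % V < 2 * P}) = V * μ {x | r x % V < 2 * P} := by
          rw [hV]; push_cast; ring
      _ ≤ 2 * (2 * P : ℕ) := h1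
      _ = P * 4 := by push_cast; ring
  · refine le_trans (measure_mono fun x hx => ?_) ((measure_height_lt_le hT hrm hr R).trans hr2)
    by_contra hxR
    simp only [Set.mem_ofPred_eq, not_lt] at hxR
    refine hx ?_
    set a := r x % V with ha
    have haV : a < V := Nat.mod_lt _ hV0
    obtain ⟨j, hj⟩ : ∃ j, j = a / P := ⟨_, rfl⟩
    have hjK : j < B.K s := hj ▸ (Nat.div_lt_iff_lt_mul hP0).2 haV
    refine ⟨j, hjK, fun l hl => ?_⟩
    have hlP : l < P := hl.trans_le
      (Nat.mul_le_mul_right _ (Nat.pow_le_pow_right (by norm_num) hjK.le))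
    have h1 : P * j + a % P = a := hj ▸ Nat.div_add_mod a P
    have h2 : V * (r x / V) + a = r x := Nat.div_add_mod (r x) V
    have h3 : a % P < P := Nat.mod_lt _ hP0
    -- Since `V` divides `Q s`, the `j`-th starting point is congruent to `(j - 1) * P` modulo `V`.
    -- A point whose residue lies in `[j P, (j + 1) P)` is thus carried to a residue in `[P, 2 P)`,
    -- and stays below `2 P` and above `0` during the next `P` steps.
    have h4 : B.start s j + P = V * (2 ^ j * q' + 1) + P * j := by
      rw [start, hq']
      obtain ⟨k, hk⟩ : ∃ k, B.K s = k + 1 := ⟨B.K s - 1, by omega⟩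
      rw [show B.K s + j - 1 = k + j by omega, ← hP, hV, hk]
      ring
    have h5 : 2 * P ≤ V := Nat.mul_le_mul_right _ hK
    have h6 : V ≤ B.Q s := Nat.le_of_dvd (by omega) ⟨q', hq'⟩
    have h7 : B.start s j + 2 ^ j * B.w s ≤ B.Q s ^ 2 := by
      have h8 := B.start_add_le s hjK
      have h9 : 2 ^ j < 2 ^ B.K s := Nat.pow_lt_pow_right (by norm_num) hjK
      exact h8.trans (B.succ_mul_Q_le_sq (h9.trans_le (B.two_pow_K_le_Q s)))
    have h8 := B.Q_le_sq s
    obtain ⟨q, hq⟩ : ∃ q, r x / V = 2 ^ j * q' + 1 + q := by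
      refine Nat.exists_eq_add_of_le ?_
      by_contra hcon
      have h9 : r x / V ≤ 2 ^ j * q' := by omega
      have h10 : V * (r x / V) ≤ V * (2 ^ j * q') := Nat.mul_le_mul_left _ h9
      rw [mul_add, mul_one] at h4
      omega
    rw [hq, mul_add] at h2
    have h9 : r x - (B.start s j + l) = (P + a % P - l) + V * q := by omega
    rw [Set.mem_ofPred_eq, height_iterate hr _ x (by omega), h9, Nat.add_mul_mod_self_left,
      Nat.mod_eq_of_lt (by omega)]
    omega

end

theorem universallySweepingOut {ψ : ℝ → ℝ} (hψ : IsGauge ψ)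
    (hK : ∀ s : ℕ, (2 : ℝ) ^ s * (5 * ((s : ℝ) + 1) * B.d s * ψ (5 * ((s : ℝ) + 1) * B.d s)) ≤
      B.K s) :
    UniversallySweepingOut.{u} (orliczSpace.{u} ψ) (enumeration B.fullSet) := by
  intro X _ _ μ T hsys
  have := hsys.isProbabilityMeasure
  have hT := hsys.measurePreserving
  choose E hE hKE hbad using fun s => B.exists_stage_set hsys s
  set h : ℕ → ℝ := fun s => 5 * ((s : ℝ) + 1) * B.d s with hh
  have hd : ∀ s, (1 : ℝ) ≤ B.d s := fun s => by exact_mod_cast B.d_pos s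
  have hh1 : ∀ s, 1 ≤ h s := fun s => by
    have h1 : (0 : ℝ) ≤ s := by positivity
    have := hd s
    simp only [hh]
    nlinarith
  have hh0 : ∀ s, 0 ≤ h s := fun s => zero_le_one.trans (hh1 s)
  have hψ1 := hψ.one_le
  have hhψ : ∀ s, 1 ≤ h s * ψ (h s) := fun s => one_le_mul_of_one_le_of_one_le (hh1 s) (hψ1 _)
  have hterm : ∀ s, ENNReal.ofReal (h s * ψ (h s)) * μ (E s) ≤ 4 * (2 : ENNReal)⁻¹ ^ s := by
    intro s
    rw [← ENNReal.inv_pow, ← div_eq_mul_inv, ENNReal.le_div_iff_mul_le (Or.inl (by simp))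
      (Or.inl (by simp)), mul_right_comm]
    refine le_trans (mul_le_mul' ?_ le_rfl) (hKE s)
    have h1 := ENNReal.ofReal_le_ofReal (hK s)
    rw [ENNReal.ofReal_natCast, ENNReal.ofReal_mul (by positivity),
      ENNReal.ofReal_pow (by norm_num), mul_comm] at h1
    simpa using h1
  have hsum4 : ∑' s : ℕ, 4 * (2 : ENNReal)⁻¹ ^ s ≠ ⊤ := by
    rw [ENNReal.tsum_mul_left, ENNReal.tsum_geometric_two]
    exact ENNReal.mul_ne_top (by simp) (by simp)
  have hfinE : ∀ᵐ x ∂μ, {s | x ∈ E s}.Finite := by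
    refine ae_finite_setOfPred_mem (ne_top_of_le_ne_top hsum4 (ENNReal.tsum_le_tsum fun s => ?_))
    refine le_trans (le_mul_of_one_le_left' ?_) (hterm s)
    rw [← ENNReal.ofReal_one]
    exact ENNReal.ofReal_le_ofReal (hhψ s)
  have hfinbad : ∀ᵐ x ∂μ, {s | ¬∃ j < B.K s, ∀ l < 2 ^ j * B.w s,
      T^[B.start s j + l] x ∈ E s}.Finite := by
    refine ae_finite_setOfPred_mem (s := fun s => {x | ¬∃ j < B.K s, ∀ l < 2 ^ j * B.w s,
      T^[B.start s j + l] x ∈ E s}) (ne_top_of_le_ne_top (b := 2) (by simp) ?_)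
    rw [← ENNReal.tsum_geometric_two]
    exact ENNReal.tsum_le_tsum hbad
  -- With a supremum instead of a sum, almost every value is a single `h s` or `0`. So `F ψ(F)` is
  -- bounded by the sum of the separate costs, with no doubling condition on `ψ`.
  set F : X → ENNReal := fun x => ⨆ s, (E s).indicator (fun _ => ENNReal.ofReal (h s)) x with hF
  have hFm : Measurable F := Measurable.iSup fun s => measurable_const.indicator (hE s)
  have hFtop : ∀ x, {s | x ∈ E s}.Finite → x ∉ ⋃ s, E s ∨
      ∃ s, x ∈ E s ∧ F x = ENNReal.ofReal (h s) := by
    intro x hx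
    by_cases hne : {s | x ∈ E s}.Nonempty
    · right
      obtain ⟨s, hs, hmax⟩ := hx.exists_maximalFor h _ hne
      refine ⟨s, hs, le_antisymm (iSup_le fun t => ?_) ?_⟩
      · by_cases ht : x ∈ E t
        · rw [Set.indicator_of_mem ht]
          refine ENNReal.ofReal_le_ofReal ?_
          rcases le_total (h t) (h s) with h1 | h1
          · exact h1
          · exact hmax ht h1
        · simp [ht]
      · refine le_trans (le_of_eq ?_) (le_iSup _ s)
        have hs' : x ∈ E s := hs
        simp [hs']
    · left
      intro hx'
      obtain ⟨s, hs⟩ := Set.mem_iUnion.1 hx'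
      exact hne ⟨s, hs⟩
  have hlow : ∀ x s, {s | x ∈ E s}.Finite → x ∈ E s → h s ≤ (F x).toReal := by
    intro x s hx hs
    rcases hFtop x hx with h1 | ⟨t, -, ht⟩
    · exact absurd (Set.mem_iUnion.2 ⟨s, hs⟩) h1
    · refine (ENNReal.ofReal_le_iff_le_toReal (by rw [ht]; exact ENNReal.ofReal_ne_top)).1 ?_
      refine le_trans (le_of_eq ?_) (le_iSup _ s)
      simp [hs]
  refine ⟨fun x => (F x).toReal, ⟨hFm.ennreal_toReal.aemeasurable, ?_⟩, ?_⟩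
  · have hbound : ∀ᵐ x ∂μ, ENNReal.ofReal (|(F x).toReal| * ψ |(F x).toReal|) ≤
        ∑' s, (E s).indicator (fun _ => ENNReal.ofReal (h s * ψ (h s))) x := by
      filter_upwards [hfinE] with x hx
      rcases hFtop x hx with h1 | ⟨s, hs, hFs⟩
      · have : F x = 0 := by
          simp only [hF, ENNReal.iSup_eq_zero]
          intro s
          have : x ∉ E s := fun hs => h1 (Set.mem_iUnion.2 ⟨s, hs⟩)
          simp [this]
        simp [this]
      · refine le_trans (le_of_eq ?_) (ENNReal.le_tsum s)
        rw [hFs, ENNReal.toReal_ofReal (hh0 s), abs_of_nonneg (hh0 s), Set.indicator_of_mem hs]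
    refine lt_of_le_of_lt (lintegral_mono_ae hbound) ?_
    rw [lintegral_tsum fun s => (measurable_const.indicator (hE s)).aemeasurable]
    refine lt_of_le_of_lt (ENNReal.tsum_le_tsum fun s => ?_) hsum4.lt_top
    rw [lintegral_indicator_const (hE s)]
    exact hterm s
  · have hfinall : ∀ᵐ x ∂μ, ∀ m, {s | T^[m] x ∈ E s}.Finite :=
      ae_all_iff.2 fun m => (hT.iterate m).quasiMeasurePreserving.ae hfinE
    filter_upwards [hfinall, hfinbad] with x hx1 hx2
    rw [iSup_eq_top]
    intro b hb
    obtain ⟨c, hbc, -⟩ := EReal.lt_iff_exists_real_btwn.1 hb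
    obtain ⟨n, hn⟩ := exists_nat_gt c
    -- Almost every point is good for all but finitely many stages, so a good stage beyond `n`
    -- exists; it gives an average of at least `s + 1 > c`.
    obtain ⟨s, hs1, hs2⟩ := ((Set.finite_Iio (n + 1)).union hx2).infinite_compl.nonempty.imp
      fun s hs => (not_or.1 hs)
    simp only [Set.mem_Iio, not_lt] at hs1
    obtain ⟨j, hj, hjE⟩ : ∃ j < B.K s, ∀ l < 2 ^ j * B.w s, T^[B.start s j + l] x ∈ E s :=
      not_not.1 hs2
    have h1 := B.le_initialAverage_fullSet (T := T) (f := fun x => (F x).toReal) (x := x)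
      (by omega : 1 ≤ s) hj (fun _ => ENNReal.toReal_nonneg) (hh0 s)
      fun l hl => hlow _ s (hx1 _) (hjE l hl)
    rw [← ergodicAverage_card_eq B.infinite_fullSet] at h1
    refine ⟨_, hbc.trans_le (EReal.coe_le_coe_iff.2 (le_trans ?_ h1))⟩
    have h2 : (0 : ℝ) < B.d s := by linarith [hd s]
    have h3 : h s / (5 * B.d s) = s + 1 := by
      simp only [hh]; field_simp
    have h4 : (n : ℝ) + 1 ≤ s := by exact_mod_cast hs1
    rw [h3]; linarith

end BlockScheme

/-! ### Choice of the parameters -/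

theorem IsGauge.tendsto_atTop {φ : ℝ → ℝ} (h : IsGauge φ) : Tendsto φ atTop atTop := by
  refine tendsto_atTop_atTop_of_monotone h.monotone fun b => ?_
  by_contra hcon
  push Not at hcon
  refine h.unbounded ⟨b, ?_⟩
  rintro _ ⟨x, rfl⟩
  exact (hcon x).le

theorem eventually_mul_le_of_tendsto_rpow_div {φ ψ : ℝ → ℝ} (hφ : IsGauge φ) (hψ : IsGauge ψ)
    (hk : ∃ k : ℝ, 0 < k ∧ Tendsto (fun u => φ u ^ (k / (k + 1)) / ψ u) atTop atTop) (M : ℝ) :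
    ∀ᶠ u in atTop, M * ψ u ≤ φ u := by
  obtain ⟨k, hk0, hk⟩ := hk
  filter_upwards [hk.eventually (eventually_ge_atTop M)] with u hu
  have hψ0 : 0 < ψ u := zero_lt_one.trans_le (hψ.one_le u)
  rw [le_div_iff₀ hψ0] at hu
  refine hu.trans ?_
  calc φ u ^ (k / (k + 1)) ≤ φ u ^ (1 : ℝ) := by
        refine Real.rpow_le_rpow_of_exponent_le (hφ.one_le u) ?_
        rw [div_le_one (by positivity)]; linarith
    _ = φ u := Real.rpow_one _

/-- A gauge of sublogarithmic growth does not grow much from `v` to `v ^ 4`, for suitable large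
`v`. -/
theorem frequently_lt_two_mul {φ : ℝ → ℝ} (hφ : IsGauge φ)
    (hlog : ∀ j : ℝ, 0 < j → φ =o[atTop] fun x => Real.log x ^ j) :
    ∃ᶠ v in atTop, φ (v ^ 4) < 2 * φ v := by
  intro hcon
  obtain ⟨v₀, hv₀⟩ := eventually_atTop.1 hcon
  set v := max v₀ 2 with hv
  have hv2 : 2 ≤ v := le_max_right _ _
  have hv1 : 1 ≤ v := by linarith
  have hpow : ∀ n : ℕ, v ≤ v ^ 4 ^ n := fun n => le_self_pow₀ hv1 (by positivity)
  -- Here `2 ^ n` is the square root of `4 ^ n`, so along `x = v ^ 4 ^ n` the function would be at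
  -- least `√(log x / log v)`, against the growth hypothesis with exponent `1 / 2`.
  have hgrow : ∀ n : ℕ, (2 : ℝ) ^ n ≤ φ (v ^ 4 ^ n) := by
    intro n
    induction n with
    | zero => simpa using hφ.one_le _
    | succ n ih =>
      have h1 := hv₀ (v ^ 4 ^ n) ((le_max_left _ _).trans (hpow n))
      rw [not_lt, ← pow_mul, ← pow_succ] at h1
      rw [pow_succ]; linarith
  have hlogv : 0 < Real.log v := Real.log_pos (by linarith)
  have hsq : 0 < √(Real.log v) := Real.sqrt_pos.2 hlogv
  have ho := (hlog (1 / 2) (by norm_num)).def (show 0 < 1 / (2 * √(Real.log v)) by positivity)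
  have htend : Tendsto (fun n : ℕ => v ^ 4 ^ n) atTop atTop :=
    (tendsto_pow_atTop_atTop_of_one_lt (by linarith)).comp
      (tendsto_pow_atTop_atTop_of_one_lt (by norm_num))
  obtain ⟨n, hn⟩ := (htend.eventually ho).exists
  have h2 : (0 : ℝ) ≤ (2 : ℝ) ^ n := by positivity
  rw [Real.norm_of_nonneg (zero_le_one.trans (hφ.one_le _)), ← Real.sqrt_eq_rpow, Real.log_pow,
    Real.norm_of_nonneg (Real.sqrt_nonneg _), Nat.cast_pow, Real.sqrt_mul (by positivity),
    show ((4 : ℕ) : ℝ) ^ n = (2 ^ n) ^ 2 by rw [← pow_mul, mul_comm, pow_mul]; norm_num,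
    Real.sqrt_sq h2] at hn
  have h3 : 1 / (2 * √(Real.log v)) * (2 ^ n * √(Real.log v)) = 2 ^ n / 2 := by field_simp
  have h4 := hgrow n
  have h5 : (0 : ℝ) < 2 ^ n := by positivity
  linarith

/-- For suitable `v` and `d = ⌊v ^ 4 / c⌋` one has `c d ≤ v ^ 4` and `v ≤ √d`. Hence `M ψ(c d) ≤ M
ψ(v ^ 4) ≤ φ(v ^ 4) / 2 < φ(v) ≤ φ(√d)`. -/
theorem exists_nat_mul_le_sqrt {φ ψ : ℝ → ℝ} (hφ : IsGauge φ) (hψ : IsGauge ψ)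
    (hlog : ∀ j : ℝ, 0 < j → φ =o[atTop] fun x => Real.log x ^ j)
    (hk : ∃ k : ℝ, 0 < k ∧ Tendsto (fun u => φ u ^ (k / (k + 1)) / ψ u) atTop atTop)
    {c M : ℝ} (hc : 1 ≤ c) (hM : 0 ≤ M) (n : ℕ) :
    ∃ d : ℕ, n ≤ d ∧ M * ψ (c * d) ≤ φ √d := by
  have hev := (tendsto_pow_atTop (n := 4) (by norm_num)).eventually
    (eventually_mul_le_of_tendsto_rpow_div hφ hψ hk (2 * M))
  obtain ⟨v, hv, hev, hvc⟩ := ((frequently_lt_two_mul hφ hlog).and_eventually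
    (hev.and (eventually_ge_atTop (2 * c + n + 1)))).exists
  have hn0 : (0 : ℝ) ≤ n := by positivity
  have hv1 : 1 ≤ v := by linarith
  set d := ⌊v ^ 4 / c⌋₊ with hd
  have hd1 : (d : ℝ) ≤ v ^ 4 / c := Nat.floor_le (by positivity)
  have hd2 : v ^ 4 / c < d + 1 := Nat.lt_floor_add_one _
  have hv2 : v ^ 2 + 1 ≤ v ^ 4 / c := by
    rw [le_div_iff₀ (by linarith)]
    have h1 : 2 * c ≤ v ^ 2 := by nlinarith
    have h2 : 1 ≤ v ^ 2 := by nlinarith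
    nlinarith
  have hvd : v ^ 2 ≤ d := by linarith
  refine ⟨d, ?_, ?_⟩
  · have : (n : ℝ) ≤ d := by nlinarith
    exact_mod_cast this
  · have h1 : φ v ≤ φ √d := hφ.monotone (Real.le_sqrt_of_sq_le hvd)
    have h2 : ψ (c * d) ≤ ψ (v ^ 4) := hψ.monotone (by
      rw [le_div_iff₀ (by linarith)] at hd1; linarith)
    have h3 : M * ψ (c * d) ≤ M * ψ (v ^ 4) := mul_le_mul_of_nonneg_left h2 hM
    linarith

theorem exists_parameters {φ ψ : ℝ → ℝ} (hφ : IsGauge φ) (hψ : IsGauge ψ)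
    (hlog : ∀ j : ℝ, 0 < j → φ =o[atTop] fun x => Real.log x ^ j)
    (hk : ∃ k : ℝ, 0 < k ∧ Tendsto (fun u => φ u ^ (k / (k + 1)) / ψ u) atTop atTop) (s : ℕ) :
    ∃ d K : ℕ, s + 1 ≤ d ∧ 2 ≤ K ∧ (K : ℝ) * 2 ^ s ≤ d * φ √d ∧
      (2 : ℝ) ^ s * (5 * ((s : ℝ) + 1) * d * ψ (5 * ((s : ℝ) + 1) * d)) ≤ K := by
  have hs0 : (0 : ℝ) ≤ s := by positivity
  set c : ℝ := 5 * ((s : ℝ) + 1) with hc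
  have hc5 : 5 ≤ c := by linarith
  -- The two factors `2 ^ s` serve the two summability conditions; the further `2` absorbs rounding
  -- up `K = ⌈a⌉ ≤ 2 a`.
  obtain ⟨d, hd, hle⟩ := exists_nat_mul_le_sqrt hφ hψ hlog hk (c := c) (M := 2 * 2 ^ s * 2 ^ s * c)
    (by linarith) (by positivity) (s + 1)
  have hd1 : (1 : ℝ) ≤ d := by exact_mod_cast (by omega : 1 ≤ d)
  set a : ℝ := (2 : ℝ) ^ s * (c * d * ψ (c * d)) with ha
  have hp : (1 : ℝ) ≤ 2 ^ s := one_le_pow₀ (by norm_num)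
  have ha5 : 5 ≤ a := by
    have h1 : 5 ≤ c * d := by nlinarith
    have h2 : 5 ≤ c * d * ψ (c * d) := by nlinarith [hψ.one_le (c * d)]
    nlinarith
  have h1 := Nat.le_ceil a
  have h2 := Nat.ceil_lt_add_one (show 0 ≤ a by linarith)
  refine ⟨d, ⌈a⌉₊, hd, ?_, ?_, h1⟩
  · have : (2 : ℝ) ≤ ⌈a⌉₊ := by linarith
    exact_mod_cast this
  · calc (⌈a⌉₊ : ℝ) * 2 ^ s ≤ (2 * a) * 2 ^ s := by gcongr; linarith
      _ = d * (2 * 2 ^ s * 2 ^ s * c * ψ (c * d)) := by rw [ha]; ring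
      _ ≤ d * φ √d := by gcongr

/-! ### The scheme with given parameters and the conclusion -/

/-- The period `Q s` in terms of the length `L s`. -/
def stagePeriod (d K : ℕ → ℕ) (s L : ℕ) : ℕ :=
  2 * K s * 2 ^ K s * L * d (s + 1) * 2 ^ K (s + 1)

/-- The initial length `L s` of the main intervals. -/
def stageLength (d K : ℕ → ℕ) : ℕ → ℕ
  | 0 => d 0
  | s + 1 => stagePeriod d K s (stageLength d K s) ^ 2

/-- The period of a stage carries the factor `d (s + 1)` for this purpose: it makes `w = L / d` an
exact quotient in the next stage. -/
theorem dvd_stageLength (d K : ℕ → ℕ) : ∀ s, d s ∣ stageLength d K s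
  | 0 => dvd_rfl
  | s + 1 => by
    have h : d (s + 1) ∣ stagePeriod d K s (stageLength d K s) :=
      ((dvd_mul_left _ _).mul_right _)
    exact h.trans (dvd_pow_self _ (by norm_num))

theorem stageLength_pos {d K : ℕ → ℕ} (hd : ∀ s, 0 < d s) (hK : ∀ s, 2 ≤ K s) :
    ∀ s, 0 < stageLength d K s
  | 0 => hd 0
  | s + 1 => by
    have h1 := stageLength_pos hd hK s
    have h2 := hK s
    have h3 := hd (s + 1)
    rw [stageLength, stagePeriod]
    positivity

/-- The block scheme with given proportions `1 / d s` and numbers `K s` of additional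
intervals. -/
def BlockScheme.ofParameters (d K : ℕ → ℕ) (hd : ∀ s, 0 < d s) (hK : ∀ s, 2 ≤ K s) :
    BlockScheme where
  d := d
  K := K
  w s := stageLength d K s / d s
  L := stageLength d K
  Q s := stagePeriod d K s (stageLength d K s)
  d_pos := hd
  two_le_K := hK
  w_pos s := Nat.div_pos (Nat.le_of_dvd (stageLength_pos hd hK s) (dvd_stageLength d K s)) (hd s)
  L_eq s := (Nat.mul_div_cancel' (dvd_stageLength d K s)).symm
  dvd_Q s := by
    have h : stageLength d K s / d s ∣ stageLength d K s := Nat.div_dvd_of_dvd (dvd_stageLength d K s)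
    exact ((mul_dvd_mul_left _ h).mul_right _).mul_right _
  mul_L_le_Q s := by
    have h1 := hd (s + 1)
    have h2 : 0 < K s := by have := hK s; omega
    have h3 : stagePeriod d K s (stageLength d K s) =
      2 ^ K s * stageLength d K s * (2 * K s * d (s + 1) * 2 ^ K (s + 1)) := by
        rw [stagePeriod]; ring
    rw [h3]
    exact Nat.le_mul_of_pos_right _ (by positivity)
  two_pow_K_le s := by
    have h1 := hd (s + 1)
    have h2 : 0 < K s := by have := hK s; omega
    have h3 := stageLength_pos hd hK s
    rw [stagePeriod]
    exact Nat.le_mul_of_pos_left _ (by positivity)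
  L_succ _ := rfl

theorem mainTheorem3 (φ ψ : ℝ → ℝ) (hφ : IsGauge φ) (hψ : IsGauge ψ)
    (hlog : ∀ j : ℝ, 0 < j → φ =o[atTop] fun x => Real.log x ^ j)
    (hk : ∃ k : ℝ, 0 < k ∧ Tendsto (fun u => φ u ^ (k / (k + 1)) / ψ u) atTop atTop) :
    ∃ a : ℕ → ℕ, StrictMono a ∧ (∀ n, 0 < a n) ∧
      UniversallyGood.{u} (orliczSpace.{u} φ) a ∧
      UniversallySweepingOut.{u} (orliczSpace.{u} ψ) a := by
  choose d K hd hK hKφ hKψ using exists_parameters hφ hψ hlog hk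
  let B := BlockScheme.ofParameters d K (fun s => (Nat.succ_pos s).trans_le (hd s)) hK
  refine ⟨enumeration B.fullSet, enumeration_strictMono B.infinite_fullSet, fun n => ?_,
    B.universallyGood hφ hd hKφ, B.universallySweepingOut hψ hKψ⟩
  refine Nat.pos_of_ne_zero fun h0 => B.zero_notMem_fullSet ?_
  rw [← h0]
  exact enumeration_mem B.infinite_fullSet n
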